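/- Let $G=(U\cup V,E)$ be a finite simple bipartite graph with left-nodes $U$ and right-nodes $V$; write $\Gamma(w)$ for the set of edges at a vertex $w$. Let $x,\rho\in[0,1]^E$ satisfy $\sum_{e\in\Gamma(v)}x_e\le 1$ for every $v\in V$ and $\sum_{e\in\Gamma(u)}\rho_e\le 1$ for every $u\in U$. **CorrelatedExponential.** Given $\rho_1,\dots,\rho_n\ge 0$ with $\sum_i\rho_i\le 1$, run an infinite sequence of independent trials, each with outcome $i\in\{1,\dots,n\}$ with probability $\rho_i$ and outcome $0$ with probability $1-\sum_i\rho_i$, and let $T_i$ be the number of trials before $i$ is first seen. For $\rho_i\in(0,1)$ put $\alpha_i=-\log(1-\rho_i)$, draw $S_i\in[0,1]$ with density $\alpha_i e^{-\alpha_i s}/\rho_i$, and set $Z_i=\alpha_i(T_i+S_i)$; for $\rho_i\in\{0,1\}$ draw $Z_i$ from the Exponential distribution with rate $1$. All $S_i$ and these latter $Z_i$ are drawn independently of each other and of the trials. Return $Z=(Z_1,\dots,Z_n)$. **DepRound.** Put $X_e=0$ for each edge with $x_e=0$ and $X_e=1$ for each edge with $x_e=1$, and remove these edges. To each right-node $v$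 with $0<1-\sum_{e\in\Gamma(v)}x_e<1$ (the sum being over the original edges) add a dummy edge $d$ to a new left-node of its own, with $x_d=1-\sum_{e\in\Gamma(v)}x_e$ and $\rho_d=0$. In the resulting graph, for each left-node $u$ independently, draw $(Z_e)_{e\in\Gamma(u)}$ by CorrelatedExponential with input $(\rho_e)_{e\in\Gamma(u)}$. For each right-node $v$ with at least one edge, choose an edge $e\in\Gamma(v)$ that minimizes $Z_f/x_f$ over $f\in\Gamma(v)$; put $X_e=1$, and $X_f=0$ for all other $f\in\Gamma(v)$. Return $X=(X_e)_{e\in E}$. An edge-set $L\subseteq E$ is called *stable* if there are no $(u,v),(u',v')\in L$ with $u\ne u'$, $v\ne v'$ and $(u,v')\in E$ (equivalently, no two edges of $L$ are at distance exactly two in the line graph of $G$). Define $\Phi:[0,1]^4\to[0,1]$ by $$\Phi(x_1,x_2;\rho_1,\rho_2)=\frac{\big((1-\rho_1)^{1-1/x_1}-1\big)\big((1-\rho_2)^{1-1/x_2}-1\big)}{(1-\rho_1)^{1-1/x_1}(1-\rho_2)^{1-1/x_2}+\rho_1+\rho_2-1}$$ if $x_1,x_2,\rho_1,\rho_2\in(0,1)$,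 and $\Phi(x_1,x_2;\rho_1,\rho_2)=0$ otherwise. **Theorem.** $\Phi$ indeed takes values in $[0,1]$, and DepRound returns a random vector $X$ that lies in $\{0,1\}^E$ with probability one, such that: * (A1) With probability one, $\sum_{e\in\Gamma(v)}X_e\le 1$ for every right-node $v\in V$. * (A2) $\mathbf E[X_e]=x_e$ for every edge $e\in E$. * (A3) $\mathbf E\big[\prod_{e\in L}X_e\big]\le\prod_{e\in L}x_e$ for every stable edge-set $L\subseteq E$. * (A4) For any two distinct edges $e_1=(u,v_1)$, $e_2=(u,v_2)$ with a common left-node $u$, $$\mathbf E[X_{e_1}X_{e_2}]\le\big(1-\Phi(x_{e_1},x_{e_2};\rho_{e_1},\rho_{e_2})\big)\,x_{e_1}x_{e_2}.$$ -/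

import Mathlib

open MeasureTheory ProbabilityTheory

namespace DepRounding

noncomputable section

/-! ### Negatively correlated Exponential random variables -/

/-- The outcome of one trial is an index `some i` or the extra outcome `none`
(the index `0` with rate `ρ₀ = 1 - ∑ i, ρ i`).  The discrete σ-algebra is used on outcomes. -/
instance optionMeasurableSpace {ι : Type*} : MeasurableSpace (Option ι) := ⊤

/-- The law of a single trial: the value is `some i` with probability `ρ i`, and `none` with
the remaining probability `ρ₀ = 1 - ∑ i, ρ i`. -/
def trialLaw {ι : Type*} [Fintype ι] (ρ : ι → ℝ) : Measure (Option ι) :=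
  ENNReal.ofReal (1 - ∑ i, ρ i) • Measure.dirac none
    + ∑ i, ENNReal.ofReal (ρ i) • Measure.dirac (some i)

/-- The number of trials before `i` is first seen in the sequence `F` of trial outcomes.
(If `i` is never seen, the value is `0`; for `ρ i > 0` this has probability zero, and the waiting
times of indices with `ρ i = 0` are never used.) -/
def waitingTime {ι : Type*} (F : ℕ → Option ι) (i : ι) : ℕ :=
  sInf {j : ℕ | F j = some i}

/-- The Multivariate Geometric distribution with rate vector `ρ` (and `ρ₀ = 1 - ∑ i, ρ i`): the
law of the waiting times in an infinite sequence of independent trials. -/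
def multivariateGeometric {ι : Type*} [Fintype ι] (ρ : ι → ℝ) : Measure (ι → ℕ) :=
  (Measure.infinitePi fun _ : ℕ => trialLaw ρ).map waitingTime

/-- `α = - log (1 - r)`. -/
def decayRate (r : ℝ) : ℝ := -Real.log (1 - r)

/-- The law of the auxiliary variable drawn for an index with rate `r`.  For `r ∈ (0,1)` it has
density `α e^{-α s} / r` on `[0,1]`, where `α = - log (1 - r)`; otherwise it is the Exponential
distribution with rate `1`. -/
def auxLaw (r : ℝ) : Measure ℝ :=
  if 0 < r ∧ r < 1 then
    (volume.restrict (Set.Icc (0 : ℝ) 1)).withDensity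
      fun s => ENNReal.ofReal (decayRate r * Real.exp (-(decayRate r) * s) / r)
  else expMeasure 1

/-- The vector `Z` computed from the waiting times `T` and the auxiliary variables `S`. -/
def exponentialOf {ι : Type*} (ρ : ι → ℝ) (T : ι → ℕ) (S : ι → ℝ) (i : ι) : ℝ :=
  if 0 < ρ i ∧ ρ i < 1 then decayRate (ρ i) * ((T i : ℝ) + S i) else S i

/-- The law of the output of the procedure `CorrelatedExponential` on the vector `ρ`. -/
def correlatedExponential {ι : Type*} [Fintype ι] (ρ : ι → ℝ) : Measure (ι → ℝ) :=
  ((multivariateGeometric ρ).prod (Measure.pi fun i => auxLaw (ρ i))).map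
    fun ω => exponentialOf ρ ω.1 ω.2

/-! ### The rounding algorithm

A bipartite graph with left-nodes `U` and right-nodes `V` is given by its edge set
`E : Finset (U × V)`.  Only the values of `x` and `ρ` on `E` matter. -/

section Core

variable {U V : Type*} [DecidableEq U] [DecidableEq V]

/-- The edges incident to the left-node `u`. -/
def leftEdges (E : Finset (U × V)) (u : U) : Finset (U × V) := E.filter fun e => e.1 = u

/-- The edges incident to the right-node `v`. -/
def rightEdges (E : Finset (U × V)) (v : V) : Finset (U × V) := E.filter fun e => e.2 = v

/-- A minimizer of `g` over `s`; `none` only if `s` is empty.  Ties are broken by an arbitrary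
rule that depends only on the set of minimizers. -/
def argmin {α : Type*} (s : Finset α) (g : α → ℝ) : Option α :=
  open Classical in
  if h : (s.filter fun a => ∀ b ∈ s, g a ≤ g b).Nonempty then some h.choose else none

/-- The selection step: `X e = 1` if `e = (u, v)` is the edge chosen at its right-node `v`, namely
the minimizer of `Z f / x f` over the edges `f` at `v`, and `X e = 0` otherwise. -/
def selection (E : Finset (U × V)) (x : U × V → ℝ) (Z : U → V → ℝ) (e : U × V) : ℝ :=
  if argmin (rightEdges E e.2) (fun f => Z f.1 f.2 / x f) = some e then 1 else 0

/-- The law of the output of `DepRound` for a normalized input: `x` takes values in `(0,1)` and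
sums to one at each right-node that has an edge.  Each left-node independently
calls `CorrelatedExponential` on the rates of its edges.  (The vector of rates is extended by zero
to the non-edges; the additional coordinates so produced are independent of the others and are
never read.) -/
def depRoundNormalized [Fintype U] [Fintype V] (E : Finset (U × V)) (x ρ : U × V → ℝ) :
    Measure (U × V → ℝ) :=
  (Measure.pi fun u : U =>
    correlatedExponential fun v : V => if (u, v) ∈ E then ρ (u, v) else 0).map (selection E x)

/-! The reduction of a general input to a normalized one: edges with `x e ∈ {0,1}` are removed, and
a right-node whose `x`-values sum to less than one receives a dummy edge, to a new left-node of its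
own, carrying the missing mass. -/

/-- The mass missing at the right-node `v`. -/
def slack (E : Finset (U × V)) (x : U × V → ℝ) (v : V) : ℝ := 1 - ∑ e ∈ rightEdges E v, x e

/-- The edges of the normalized graph.  Its left-nodes are the old left-nodes `Sum.inl u` and one
new left-node `Sum.inr v` for each right-node `v`. -/
def normEdges [Fintype V] (E : Finset (U × V)) (x : U × V → ℝ) : Finset ((U ⊕ V) × V) :=
  open Classical in
  (E.filter fun e => 0 < x e ∧ x e < 1).image (fun e => (Sum.inl e.1, e.2))
    ∪ (Finset.univ.filter fun v : V => 0 < slack E x v ∧ slack E x v < 1).image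
        (fun v => (Sum.inr v, v))

/-- The fractional values of the normalized instance. -/
def normX (E : Finset (U × V)) (x : U × V → ℝ) : (U ⊕ V) × V → ℝ
  | (Sum.inl u, v) => x (u, v)
  | (Sum.inr _, v) => slack E x v

/-- The rates of the normalized instance. -/
def normRho (ρ : U × V → ℝ) : (U ⊕ V) × V → ℝ
  | (Sum.inl u, v) => ρ (u, v)
  | (Sum.inr _, _) => 0

/-- The output vector on the original edges, from the output `Y` on the normalized graph: edges
with `x e = 1` are always chosen, and all other removed edges are not chosen (`Y` is zero off the
edges of the normalized graph). -/
def restoreOutput (E : Finset (U × V)) (x : U × V → ℝ) (Y : (U ⊕ V) × V → ℝ) (e : U × V) : ℝ :=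
  open Classical in
  if e ∈ E ∧ x e = 1 then 1 else Y (Sum.inl e.1, e.2)

/-- The law of the random vector `X` returned by `DepRound` on the bipartite graph `E` with
fractional values `x` and rates `ρ`. -/
def depRound [Fintype U] [Fintype V] (E : Finset (U × V)) (x ρ : U × V → ℝ) :
    Measure (U × V → ℝ) :=
  (depRoundNormalized (normEdges E x) (normX E x) (normRho ρ)).map (restoreOutput E x)

end Core

/-! ### Notions used in the analysis -/

/-- A set `L` of edges is stable if it contains no two edges at distance precisely two in the line
graph: no `(u, v), (u', v') ∈ L` without common endpoint such that `(u, v')` is an edge. -/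
def IsStable {U V : Type*} (E L : Finset (U × V)) : Prop :=
  L ⊆ E ∧ ∀ e ∈ L, ∀ e' ∈ L, e.1 ≠ e'.1 → e.2 ≠ e'.2 → (e.1, e'.2) ∉ E

/-- The strength `Φ(x₁, x₂; ρ₁, ρ₂)` of the negative correlation. -/
def Phi (x₁ x₂ ρ₁ ρ₂ : ℝ) : ℝ :=
  open Classical in
  if x₁ ∈ Set.Ioo (0 : ℝ) 1 ∧ x₂ ∈ Set.Ioo (0 : ℝ) 1 ∧
      ρ₁ ∈ Set.Ioo (0 : ℝ) 1 ∧ ρ₂ ∈ Set.Ioo (0 : ℝ) 1 then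
    (((1 - ρ₁) ^ (1 - 1 / x₁) - 1) * ((1 - ρ₂) ^ (1 - 1 / x₂) - 1)) /
      ((1 - ρ₁) ^ (1 - 1 / x₁) * (1 - ρ₂) ^ (1 - 1 / x₂) + ρ₁ + ρ₂ - 1)
  else 0

end

end DepRounding

namespace DepRounding

open Filter Topology
open scoped ENNReal

/-! The proof combines negative dependence inside one left-node's vector with the exponential race
at each right-node.

Negative dependence: reveal the trials one at a time and attach to each index the conditional mean
of its payoff (`stageValue`). One trial hits at most one index, so when all payoffs move in the same
direction the product of these values is a supermartingale (`prod_trial_le`,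
`lintegral_prod_payoff_le`). The choice `α = -log (1 - ρ)` gives `e^{-α} = 1 - ρ`, so the memoryless
splitting of Exponential(1) at `α` is exactly the one-trial recursion
(`lintegral_expMeasure_eq_add`). Hence a product of functions of the coordinates, all increasing or
all decreasing, has expectation at most that for independent Exponential(1) variables
(`lintegral_correlatedExponential_prod_le`).

Race: given `Z_σ = z ≥ 0` and independent rivals, with weights summing to one, an edge of weight `w`
wins with probability `e^{-(1/w - 1) z}`, whose mean is `w`. Winning is decreasing in the edge's own
variable and increasing in the rivals'. Stability of `L` says that no left-node is used in both
roles, so left-nodes can be replaced one by one by independent exponentials (`lmarginal_prod_le`);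
this is (A3). For single edges it gives `E[X_e] ≤ x_e`, and both sides sum to one at a right-node of
the normalized graph, whence (A2).

For (A4), replace every left-node except the common one. What remains is a joint Laplace transform
of two coordinates at the points `1/x - 1`. While both indices are pending, the ratio `κ` of its
joint value to the product of the separate values may be taken constant, because those values decay
geometrically; one trial then gives a linear equation for `κ`, solved by `1 - Φ`
(`lintegral_correlatedExponential_pair_le`).

A general instance is reduced to one with mass one at each right-node that keeps an edge
(`IsInstance.isNormalized`). -/

/-- The integral of a product of functions of distinct coordinates. -/
theorem lintegral_pi_prod {ι : Type*} [Fintype ι] {X : ι → Type*} [∀ i, MeasurableSpace (X i)]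
    (μ : ∀ i, Measure (X i)) [∀ i, IsProbabilityMeasure (μ i)] (f : ∀ i, X i → ℝ≥0∞)
    (hf : ∀ i, Measurable (f i)) :
    ∫⁻ x, ∏ i, f i (x i) ∂(Measure.pi μ) = ∏ i, ∫⁻ y, f i y ∂(μ i) := by
  rw [lintegral_prod_eq_prod_lintegral_of_indepFun (μ := Measure.pi μ) Finset.univ
    (fun i x => f i (x i)) (iIndepFun_pi (fun i => (hf i).aemeasurable))
    (fun i => (hf i).comp (measurable_pi_apply i))]
  refine Finset.prod_congr rfl fun i _ => ?_
  exact (measurePreserving_eval μ i).lintegral_comp (hf i)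

/-! ### A supermartingale bound for infinitely many trials -/

/-- A nonnegative adapted process whose one-step averages do not increase: the expected limit is
at most the initial value. -/
theorem lintegral_liminf_le_of_step {X : Type*} [Countable X] [MeasurableSpace X]
    [MeasurableSingletonClass X] (μ : Measure X) [IsProbabilityMeasure μ]
    (W : ℕ → (ℕ → X) → ℝ≥0∞)
    (hdep : ∀ N F G, (∀ j < N, F j = G j) → W N F = W N G)
    (hstep : ∀ N F, ∫⁻ o, W (N + 1) (Function.update F N o) ∂μ ≤ W N F) (F₀ : ℕ → X) :
    ∫⁻ F, liminf (fun N => W N F) atTop ∂(Measure.infinitePi fun _ : ℕ => μ) ≤ W 0 F₀ := by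
  have hW : ∀ N F, W N F = W N (Function.updateFinset F₀ (Finset.range N)
      ((Finset.range N).restrict F)) := by
    intro N F
    refine hdep _ _ _ fun j hj => ?_
    simp [Function.updateFinset, hj]
  -- The first `N` coordinates range over a countable space, so no measurability of `W` has to be
  -- assumed.
  have hm' : ∀ N, Measurable fun y : (Finset.range N → X) =>
      W N (Function.updateFinset F₀ (Finset.range N) y) := fun N => measurable_of_countable _
  have hm : ∀ N, Measurable (W N) := by
    intro N
    have : W N = (fun y : (Finset.range N → X) =>
      W N (Function.updateFinset F₀ (Finset.range N) y)) ∘ (Finset.range N).restrict := by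
      funext F; exact hW N F
    rw [this]
    exact (hm' N).comp (Finset.measurable_restrict _)
  have hint : ∀ N, ∫⁻ F, W N F ∂(Measure.infinitePi fun _ : ℕ => μ)
      = (∫⋯∫⁻_(Finset.range N), W N ∂(fun _ : ℕ => μ)) F₀ := by
    intro N
    rw [lmarginal]
    exact (lintegral_congr fun F => hW N F).trans (lintegral_restrict_infinitePi
      (fun _ : ℕ => μ) (s := Finset.range N) (hm' N))
  have hle : ∀ N, (∫⋯∫⁻_(Finset.range N), W N ∂(fun _ : ℕ => μ)) F₀ ≤ W 0 F₀ := by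
    intro N
    induction N with
    | zero => simp
    | succ N ih =>
      -- The newest coordinate is integrated innermost, where `hstep` applies.
      rw [Finset.range_add_one, lmarginal_insert' _ (hm _) (by simp)]
      exact (lmarginal_mono (fun F => hstep N F) F₀).trans ih
  calc _ ≤ liminf (fun N => ∫⁻ F, W N F ∂(Measure.infinitePi fun _ : ℕ => μ)) atTop :=
        lintegral_liminf_le hm
    _ ≤ W 0 F₀ := by
        refine liminf_le_of_le (by isBoundedDefault) fun b hb => ?_
        obtain ⟨N, hN⟩ := hb.exists
        exact hN.trans ((hint N).le.trans (hle N))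

/-! ### Waiting times and conditional values after finitely many trials -/

section Trials

variable {ι : Type*}

theorem measurableSet_trial_eq {ι : Type*} (j : ℕ) (i : ι) :
    MeasurableSet {F : ℕ → Option ι | F j = some i} := by
  have h : MeasurableSet ({some i} : Set (Option ι)) := trivial
  exact (measurable_pi_apply (X := fun _ : ℕ => Option ι) j) h

theorem measurable_waitingTime : Measurable (waitingTime : (ℕ → Option ι) → ι → ℕ) := by
  refine measurable_pi_lambda _ fun i => ?_
  have hs : ∀ j, MeasurableSet {F : ℕ → Option ι | F j = some i} :=
    fun j => measurableSet_trial_eq j i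
  have heq : ∀ n : ℕ, MeasurableSet {F : ℕ → Option ι | waitingTime F i = n} := by
    intro n
    -- Since `sInf ∅ = 0`, the fibre over `0` also contains the sequences in which `i` never occurs.
    have : {F : ℕ → Option ι | waitingTime F i = n} =
        {F | (F n = some i ∧ ∀ j < n, F j ≠ some i) ∨ (n = 0 ∧ ∀ j, F j ≠ some i)} := by
      ext F
      simp only [waitingTime, Set.mem_ofPred_eq]
      constructor
      · intro h
        by_cases hne : {j | F j = some i}.Nonempty
        · left
          refine ⟨h ▸ Nat.sInf_mem hne, fun j hj hF => ?_⟩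
          exact absurd (Nat.sInf_le (show j ∈ {j | F j = some i} from hF)) (by omega)
        · right
          rw [Set.not_nonempty_iff_eq_empty] at hne
          refine ⟨by rw [← h, hne]; simp, fun j hj => ?_⟩
          exact (Set.eq_empty_iff_forall_notMem.1 hne j) hj
      · rintro (⟨h, h'⟩ | ⟨h, h'⟩)
        · refine le_antisymm (Nat.sInf_le h) ?_
          by_contra! hlt
          exact h' _ hlt (Nat.sInf_mem (s := {j | F j = some i}) ⟨n, h⟩)
        · have : {j | F j = some i} = ∅ := Set.eq_empty_iff_forall_notMem.2 h'
          rw [this, h]; simp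
    rw [this]
    have h1 : MeasurableSet {F : ℕ → Option ι | ∀ j < n, F j ≠ some i} := by
      simp only [Set.ofPred_forall]
      exact .iInter fun j => .iInter fun _ => (hs j).compl
    have h2 : MeasurableSet {F : ℕ → Option ι | ∀ j, F j ≠ some i} := by
      simp only [Set.ofPred_forall]
      exact .iInter fun j => (hs j).compl
    exact ((hs n).inter h1).union ((MeasurableSet.const _).inter h2)
  exact measurable_to_countable' fun n => heq n

/-- The outcome `i` occurs among the first `N` trials. -/
def Seen (N : ℕ) (F : ℕ → Option ι) (i : ι) : Prop := ∃ j < N, F j = some i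

theorem seen_congr {N : ℕ} {F G : ℕ → Option ι} (h : ∀ j < N, F j = G j) (i : ι) :
    Seen N F i ↔ Seen N G i := by
  constructor <;> rintro ⟨j, hj, e⟩
  · exact ⟨j, hj, (h j hj) ▸ e⟩
  · exact ⟨j, hj, (h j hj).trans e⟩

theorem seen_succ_update {N : ℕ} {F : ℕ → Option ι} {o : Option ι} {i : ι} :
    Seen (N + 1) (Function.update F N o) i ↔ Seen N F i ∨ o = some i := by
  constructor
  · rintro ⟨j, hj, e⟩
    rcases Nat.lt_succ_iff_lt_or_eq.1 hj with h | rfl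
    · left; exact ⟨j, h, by rwa [Function.update_of_ne h.ne] at e⟩
    · right; simpa using e
  · rintro (⟨j, hj, e⟩ | rfl)
    · exact ⟨j, by omega, by rwa [Function.update_of_ne hj.ne]⟩
    · exact ⟨N, by omega, by simp⟩

theorem waitingTime_congr {N : ℕ} {F G : ℕ → Option ι} (h : ∀ j < N, F j = G j) {i : ι}
    (hi : Seen N F i) : waitingTime F i = waitingTime G i := by
  obtain ⟨j, hj, e⟩ := hi
  have eG : G j = some i := h j hj ▸ e
  have hF := Nat.sInf_le (show j ∈ {j | F j = some i} from e)
  have hG := Nat.sInf_le (show j ∈ {j | G j = some i} from eG)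
  have mF := Nat.sInf_mem (s := {j | F j = some i}) ⟨j, e⟩
  have mG := Nat.sInf_mem (s := {j | G j = some i}) ⟨j, eG⟩
  refine le_antisymm (Nat.sInf_le ?_) (Nat.sInf_le ?_)
  · exact (h _ (by unfold waitingTime; omega)).trans mG
  · exact (h _ (by unfold waitingTime; omega)).symm.trans mF

theorem waitingTime_update {N : ℕ} {F : ℕ → Option ι} {i : ι} (hi : ¬ Seen N F i) :
    waitingTime (Function.update F N (some i)) i = N := by
  refine le_antisymm (Nat.sInf_le (by simp)) ?_
  by_contra! hlt
  refine hi ⟨_, hlt, ?_⟩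
  have := Nat.sInf_mem (s := {j | Function.update F N (some i) j = some i}) ⟨N, by simp⟩
  rw [Set.mem_ofPred_eq, Function.update_of_ne] at this
  · exact this
  · exact hlt.ne

open Classical in
/-- The value attached to the index `i` after `N` trials: the payoff `H` of its waiting time if it
has been seen, and the value `m N` of waiting on otherwise. -/
noncomputable def stageValue (H m : ℕ → ℝ) (N : ℕ) (F : ℕ → Option ι) (i : ι) : ℝ :=
  if Seen N F i then H (waitingTime F i) else m N

theorem stageValue_congr {H m : ℕ → ℝ} {N : ℕ} {F G : ℕ → Option ι} (h : ∀ j < N, F j = G j)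
    (i : ι) : stageValue H m N F i = stageValue H m N G i := by
  unfold stageValue
  by_cases hi : Seen N F i
  · rw [if_pos hi, if_pos ((seen_congr h i).1 hi), waitingTime_congr h hi]
  · rw [if_neg hi, if_neg (mt (seen_congr h i).2 hi)]

theorem stageValue_update_of_seen {H m : ℕ → ℝ} {N : ℕ} {F : ℕ → Option ι} {i : ι}
    (hi : Seen N F i) (o : Option ι) :
    stageValue H m (N + 1) (Function.update F N o) i = stageValue H m N F i := by
  unfold stageValue
  rw [if_pos (seen_succ_update.2 (.inl hi)), if_pos hi,
    waitingTime_congr (N := N) (G := Function.update F N o) _ hi]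
  intro j hj
  rw [Function.update_of_ne hj.ne]

open Classical in
theorem stageValue_update_of_not_seen {H m : ℕ → ℝ} {N : ℕ} {F : ℕ → Option ι} {i : ι}
    (hi : ¬ Seen N F i) (o : Option ι) :
    stageValue H m (N + 1) (Function.update F N o) i = if o = some i then H N else m (N + 1) := by
  unfold stageValue
  simp only [seen_succ_update, hi, false_or]
  split_ifs with h
  · rw [h, waitingTime_update hi]
  · rfl

theorem stageValue_nonneg {H m : ℕ → ℝ} (hH : ∀ t, 0 ≤ H t) (hm : ∀ t, 0 ≤ m t) (N : ℕ)
    (F : ℕ → Option ι) (i : ι) : 0 ≤ stageValue H m N F i := by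
  unfold stageValue; split_ifs
  · exact hH _
  · exact hm _

variable [Fintype ι] {ρ : ι → ℝ}

theorem lintegral_trialLaw (ρ : ι → ℝ) (f : Option ι → ℝ≥0∞) :
    ∫⁻ o, f o ∂(trialLaw ρ)
      = ENNReal.ofReal (1 - ∑ i, ρ i) * f none + ∑ i, ENNReal.ofReal (ρ i) * f (some i) := by
  simp [trialLaw]

theorem isProbabilityMeasure_trialLaw (h0 : ∀ i, 0 ≤ ρ i) (h1 : ∑ i, ρ i ≤ 1) :
    IsProbabilityMeasure (trialLaw ρ) := by
  constructor
  have := lintegral_trialLaw ρ (fun _ => 1)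
  simp only [lintegral_const, one_mul, mul_one] at this
  rw [this, ← ENNReal.ofReal_sum_of_nonneg (fun i _ => h0 i),
    ← ENNReal.ofReal_add (by linarith) (Finset.sum_nonneg fun i _ => h0 i)]
  simp

/-- A trial law integrates the nonnegative real function `f` to the finite convex combination. -/
theorem lintegral_trialLaw_ofReal (h0 : ∀ i, 0 ≤ ρ i) (h1 : ∑ i, ρ i ≤ 1) (f : Option ι → ℝ)
    (hf : ∀ o, 0 ≤ f o) :
    ∫⁻ o, ENNReal.ofReal (f o) ∂(trialLaw ρ)
      = ENNReal.ofReal ((1 - ∑ i, ρ i) * f none + ∑ i, ρ i * f (some i)) := by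
  rw [lintegral_trialLaw, ENNReal.ofReal_add (mul_nonneg (by linarith) (hf _))
    (Finset.sum_nonneg fun i _ => mul_nonneg (h0 i) (hf _)),
    ENNReal.ofReal_mul (by linarith), ENNReal.ofReal_sum_of_nonneg
      (fun i _ => mul_nonneg (h0 i) (hf _))]
  congr 1
  exact Finset.sum_congr rfl fun i _ => (ENNReal.ofReal_mul (h0 i)).symm

/-- An index of rate in `(0,1)` is almost surely seen. -/
theorem ae_seen (h0 : ∀ i, 0 ≤ ρ i) (h1 : ∑ i, ρ i ≤ 1) {i : ι} (hi : 0 < ρ i) (hi' : ρ i < 1) :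
    ∀ᵐ F ∂(Measure.infinitePi fun _ : ℕ => trialLaw ρ), ∃ N, Seen N F i := by
  classical
  have := isProbabilityMeasure_trialLaw h0 h1
  -- The process equal to `(1 - ρ i)^{-N}` until `i` is seen and to `0` afterwards keeps its mean.
  -- It tends to infinity if `i` is never seen, while its expected limit is at most `1`, so that
  -- event is null.
  set m : ℕ → ℝ := fun N => ((1 - ρ i)⁻¹) ^ N with hm
  have hpos : 0 < 1 - ρ i := by linarith
  have hm0 : ∀ N, 0 ≤ m N := fun N => by positivity
  have key := lintegral_liminf_le_of_step (trialLaw ρ)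
    (fun N F => ENNReal.ofReal (stageValue (fun _ => 0) m N F i))
    (fun N F G h => by simp only [stageValue_congr h i]) (by
      intro N F
      rw [lintegral_trialLaw_ofReal h0 h1 _
        (fun o => stageValue_nonneg (fun _ => le_rfl) hm0 _ _ _)]
      refine ENNReal.ofReal_le_ofReal ?_
      by_cases hs : Seen N F i
      · simp only [stageValue_update_of_seen hs]
        have : stageValue (fun _ => 0) m N F i = 0 := if_pos hs
        simp [this]
      · simp only [stageValue_update_of_not_seen hs]
        have e : stageValue (fun _ => 0) m N F i = m N := if_neg hs
        have e2 : ∑ k, ρ k * (if some k = some i then 0 else m (N + 1))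
            = (∑ k, ρ k - ρ i) * m (N + 1) := by
          rw [sub_mul, Finset.sum_mul, ← Finset.sum_erase_add _ _ (Finset.mem_univ i),
            ← Finset.sum_erase_add _ (fun k => ρ k * m (N + 1)) (Finset.mem_univ i)]
          simp only [if_true, mul_zero, add_zero, add_sub_cancel_right]
          refine Finset.sum_congr rfl fun k hk => ?_
          rw [if_neg]
          simpa using Finset.ne_of_mem_erase hk
        simp only [reduceCtorEq, if_false]
        rw [e, e2, ← add_mul]
        have : 1 - ∑ i, ρ i + (∑ k, ρ k - ρ i) = 1 - ρ i := by ring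
        rw [this, hm]
        simp only [pow_succ]
        field_simp
        exact le_rfl) (fun _ => none)
  have hlim : ∀ F : ℕ → Option ι, (¬ ∃ N, Seen N F i) →
      liminf (fun N => ENNReal.ofReal (stageValue (fun _ => 0) m N F i)) atTop = ⊤ := by
    intro F hF
    refine Tendsto.liminf_eq ?_
    have : ∀ N, stageValue (fun _ => 0) m N F i = m N := fun N => if_neg fun h => hF ⟨N, h⟩
    simp only [this]
    exact ENNReal.tendsto_ofReal_atTop.comp
      (tendsto_pow_atTop_atTop_of_one_lt ((one_lt_inv₀ hpos).2 (by linarith)))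
  rw [ae_iff]
  have hlt : ∫⁻ F, liminf (fun N => ENNReal.ofReal (stageValue (fun _ => 0) m N F i)) atTop
      ∂(Measure.infinitePi fun _ : ℕ => trialLaw ρ) ≠ ⊤ :=
    ne_top_of_le_ne_top ENNReal.ofReal_ne_top key
  by_contra hne
  refine hlt (top_le_iff.1 ?_)
  have hms : MeasurableSet {F : ℕ → Option ι | ¬ ∃ N, Seen N F i} := by
    have : {F : ℕ → Option ι | ¬ ∃ N, Seen N F i} = ⋂ j, {F | F j = some i}ᶜ := by
      ext F
      simp only [Seen, Set.mem_ofPred_eq, Set.mem_iInter, Set.mem_compl_iff]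
      exact ⟨fun h j hj => h ⟨j + 1, j, by omega, hj⟩, fun h ⟨N, j, _, hj⟩ => h j hj⟩
    rw [this]
    exact .iInter fun j => (measurableSet_trial_eq j i).compl
  calc (⊤ : ℝ≥0∞) = ∫⁻ F in {F : ℕ → Option ι | ¬ ∃ N, Seen N F i}, ⊤
        ∂(Measure.infinitePi fun _ : ℕ => trialLaw ρ) := by
        rw [setLIntegral_const, ENNReal.top_mul hne]
    _ = ∫⁻ F in {F : ℕ → Option ι | ¬ ∃ N, Seen N F i},
        liminf (fun N => ENNReal.ofReal (stageValue (fun _ => 0) m N F i)) atTop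
        ∂(Measure.infinitePi fun _ : ℕ => trialLaw ρ) :=
        setLIntegral_congr_fun hms fun F hF => (hlim F hF).symm
    _ ≤ _ := setLIntegral_le_lintegral _ _

end Trials

/-! ### Products of payoffs as supermartingales -/

section Stages

variable {ι : Type*}

/-- The pairwise-product inequality behind negative dependence of the indicators of one trial. -/
theorem prod_trial_le [DecidableEq ι] (s : Finset ι) (ρ a b : ι → ℝ) (hρ : ∀ i, 0 ≤ ρ i)
    (hρ1 : ∀ i, ρ i ≤ 1) (ha : ∀ i, 0 ≤ a i) (hb : ∀ i, 0 ≤ b i)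
    (hab : ∀ i j, 0 ≤ (b i - a i) * (b j - a j)) :
    ∏ k ∈ s, a k + ∑ i ∈ s, ρ i * (∏ k ∈ s, (if i = k then b k else a k) - ∏ k ∈ s, a k)
      ≤ ∏ k ∈ s, (a k + ρ k * (b k - a k)) := by
  induction s using Finset.induction_on with
  | empty => simp
  | insert j s hj ih =>
    have hsum : ∑ i ∈ s, ρ i * (∏ k ∈ insert j s, (if i = k then b k else a k)
          - ∏ k ∈ insert j s, a k)
        = a j * ∑ i ∈ s, ρ i * (∏ k ∈ s, (if i = k then b k else a k) - ∏ k ∈ s, a k) := by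
      rw [Finset.mul_sum]
      refine Finset.sum_congr rfl fun i hi => ?_
      rw [Finset.prod_insert hj, Finset.prod_insert hj, if_neg (fun h : i = j => hj (h ▸ hi))]
      ring
    have hself : ∏ k ∈ s, (if j = k then b k else a k) = ∏ k ∈ s, a k :=
      Finset.prod_congr rfl fun k hk => if_neg fun h : j = k => hj (h ▸ hk)
    -- Multiplied by `ρ j`, this is the amount lost when `j` is treated as independent of `s`: no
    -- trial hits both `j` and an index of `s`. All `b - a` have compatible signs, so it is
    -- nonnegative.
    have hcross : 0 ≤ (b j - a j) *
        ∑ i ∈ s, ρ i * (∏ k ∈ s, (if i = k then b k else a k) - ∏ k ∈ s, a k) := by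
      rw [Finset.mul_sum]
      refine Finset.sum_nonneg fun i hi => ?_
      have e : ∏ k ∈ s.erase i, (if i = k then b k else a k) = ∏ k ∈ s.erase i, a k :=
        Finset.prod_congr rfl fun k hk => if_neg (Finset.ne_of_mem_erase hk).symm
      rw [← Finset.mul_prod_erase s _ hi, ← Finset.mul_prod_erase s a hi, if_pos rfl, e]
      have h1 : 0 ≤ ∏ k ∈ s.erase i, a k := Finset.prod_nonneg fun k _ => ha k
      have h2 := mul_nonneg (mul_nonneg (hρ i) h1) (hab j i)
      nlinarith [h2]
    have hfac : 0 ≤ a j + ρ j * (b j - a j) := by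
      nlinarith [mul_nonneg (hρ j) (hb j), mul_nonneg (sub_nonneg.2 (hρ1 j)) (ha j)]
    rw [Finset.sum_insert hj, hsum, Finset.prod_insert hj, Finset.prod_insert hj,
      Finset.prod_insert hj, if_pos rfl, hself]
    nlinarith [mul_le_mul_of_nonneg_left ih hfac, mul_nonneg (hρ j) hcross]

variable [Fintype ι] {ρ : ι → ℝ}

/-- Indices with rate in `(0,1)` are almost surely seen, after which the value is frozen at the
payoff. For the other rates payoff and pending value are one constant, so the default waiting time
of an unseen index does no harm. -/
theorem ae_eventually_stageValue_eq (h0 : ∀ i, 0 ≤ ρ i) (h1 : ∑ i, ρ i ≤ 1) {H m : ι → ℕ → ℝ}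
    (hdeg : ∀ i, (0 < ρ i ∧ ρ i < 1) ∨ ∀ N t, m i N = H i t) :
    ∀ᵐ F ∂(Measure.infinitePi fun _ : ℕ => trialLaw ρ),
      ∀ᶠ N in atTop, ∀ i, stageValue (H i) (m i) N F i = H i (waitingTime F i) := by
  have : ∀ᵐ F ∂(Measure.infinitePi fun _ : ℕ => trialLaw ρ),
      ∀ i, (0 < ρ i ∧ ρ i < 1) → ∃ N, Seen N F i := by
    rw [ae_all_iff]
    intro i
    by_cases hi : 0 < ρ i ∧ ρ i < 1
    · filter_upwards [ae_seen h0 h1 hi.1 hi.2] with F hF _ using hF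
    · exact ae_of_all _ fun F h => absurd h hi
  filter_upwards [this] with F hF
  rw [eventually_all]
  intro i
  rcases hdeg i with hi | hi
  · obtain ⟨N, j, hj, e⟩ := hF i hi
    filter_upwards [eventually_ge_atTop N] with M hM
    exact if_pos ⟨j, hj.trans_le hM, e⟩
  · refine Eventually.of_forall fun N => ?_
    unfold stageValue
    split_ifs
    · rfl
    · exact hi _ _

/-- Negative dependence of the waiting times: the expected product of payoffs is at most the
product of the expected payoffs, if the payoffs all increase or all decrease. -/
theorem lintegral_prod_payoff_le (h0 : ∀ i, 0 ≤ ρ i) (h1 : ∑ i, ρ i ≤ 1) {H m : ι → ℕ → ℝ}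
    (hH : ∀ i t, 0 ≤ H i t) (hm : ∀ i t, 0 ≤ m i t)
    (hrec : ∀ i N, m i N = ρ i * H i N + (1 - ρ i) * m i (N + 1))
    (hdeg : ∀ i, (0 < ρ i ∧ ρ i < 1) ∨ ∀ N t, m i N = H i t)
    (hsign : ∀ N i j, 0 ≤ (H i N - m i (N + 1)) * (H j N - m j (N + 1))) :
    ∫⁻ F, ENNReal.ofReal (∏ i, H i (waitingTime F i))
        ∂(Measure.infinitePi fun _ : ℕ => trialLaw ρ)
      ≤ ENNReal.ofReal (∏ i, m i 0) := by
  classical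
  have := isProbabilityMeasure_trialLaw h0 h1
  have hρ1 : ∀ i, ρ i ≤ 1 := fun i =>
    (Finset.single_le_sum (fun j _ => h0 j) (Finset.mem_univ i)).trans h1
  have key := lintegral_liminf_le_of_step (trialLaw ρ)
    (fun N F => ENNReal.ofReal (∏ i, stageValue (H i) (m i) N F i))
    (fun N F G h => by simp only [fun i => stageValue_congr (H := H i) (m := m i) h i]) (by
      intro N F
      rw [lintegral_trialLaw_ofReal h0 h1 _
        (fun o => Finset.prod_nonneg fun i _ => stageValue_nonneg (hH i) (hm i) _ _ _)]
      refine ENNReal.ofReal_le_ofReal ?_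
      -- `a` and `b` are the values after a trial that misses, respectively hits, the index; they
      -- coincide once it has been seen.
      set a : ι → ℝ := fun i =>
        if Seen N F i then H i (waitingTime F i) else m i (N + 1) with ha
      set b : ι → ℝ := fun i => if Seen N F i then H i (waitingTime F i) else H i N with hb
      have hup : ∀ o i, stageValue (H i) (m i) (N + 1) (Function.update F N o) i
          = if o = some i then b i else a i := by
        intro o i
        by_cases hs : Seen N F i
        · rw [stageValue_update_of_seen hs]
          simp [stageValue, ha, hb, hs]
        · rw [stageValue_update_of_not_seen hs]
          simp [ha, hb, hs]
      have hst : ∀ i, stageValue (H i) (m i) N F i = a i + ρ i * (b i - a i) := by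
        intro i
        by_cases hs : Seen N F i
        · simp [stageValue, ha, hb, hs]
        · simp only [stageValue, ha, hb, hs, if_false]
          rw [hrec i N]; ring
      simp only [hup, hst, reduceCtorEq, if_false, Option.some.injEq]
      have := prod_trial_le Finset.univ ρ a b h0 hρ1
        (fun i => by simp only [ha]; split_ifs; exacts [hH _ _, hm _ _])
        (fun i => by simp only [hb]; split_ifs; exacts [hH _ _, hH _ _])
        (fun i j => by
          simp only [ha, hb]
          split_ifs
          all_goals first | simp | exact hsign N i j)
      refine le_trans (le_of_eq ?_) this
      simp only [mul_sub, Finset.sum_sub_distrib, ← Finset.sum_mul]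
      ring) (fun _ => none)
  have hfin : ENNReal.ofReal (∏ i, stageValue (H i) (m i) 0 (fun _ => none) i)
      = ENNReal.ofReal (∏ i, m i 0) := by simp [stageValue, Seen]
  rw [← hfin]
  refine le_trans (lintegral_mono_ae ?_) key
  filter_upwards [ae_eventually_stageValue_eq h0 h1 hdeg] with F hF
  refine le_of_eq (Tendsto.liminf_eq ?_).symm
  refine tendsto_const_nhds.congr' ?_
  filter_upwards [hF] with N hN
  simp only [hN]

/-- The expected product of two payoffs, when the value of the two-index problem while both are
pending is `κ` times the product of the separate values. -/
theorem lintegral_payoff_pair_le (h0 : ∀ i, 0 ≤ ρ i) (h1 : ∑ i, ρ i ≤ 1) {H m : ι → ℕ → ℝ}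
    (hH : ∀ i t, 0 ≤ H i t) (hm : ∀ i t, 0 ≤ m i t)
    (hdeg : ∀ i, (0 < ρ i ∧ ρ i < 1) ∨ ∀ N t, m i N = H i t)
    (hrec : ∀ i N, m i N = ρ i * H i N + (1 - ρ i) * m i (N + 1))
    {i j : ι} (hij : i ≠ j) (hi0 : 0 < ρ i) (hi1 : ρ i < 1) {κ : ℝ} (hκ : 0 ≤ κ)
    (hstep : ∀ N, ρ i * (H i N * m j (N + 1)) + ρ j * (m i (N + 1) * H j N)
      + (1 - ρ i - ρ j) * (m i (N + 1) * m j (N + 1) * κ) ≤ m i N * m j N * κ) :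
    ∫⁻ F, ENNReal.ofReal (H i (waitingTime F i) * H j (waitingTime F j))
        ∂(Measure.infinitePi fun _ : ℕ => trialLaw ρ)
      ≤ ENNReal.ofReal (m i 0 * m j 0 * κ) := by
  classical
  have := isProbabilityMeasure_trialLaw h0 h1
  -- The correction `κ` applies only while both indices are pending. Once one is seen, the other
  -- evolves as an exact martingale; as `i` is almost surely seen, the correction is absent in the
  -- limit.
  set c : ℕ → (ℕ → Option ι) → ℝ :=
    fun N F => if ¬ Seen N F i ∧ ¬ Seen N F j then κ else 1 with hc
  have hc0 : ∀ N F, 0 ≤ c N F := by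
    intro N F; simp only [hc]; split_ifs
    · exact hκ
    · exact zero_le_one
  have hst0 : ∀ N F k, 0 ≤ stageValue (H k) (m k) N F k := fun N F k =>
    stageValue_nonneg (hH k) (hm k) _ _ _
  have key := lintegral_liminf_le_of_step (trialLaw ρ)
    (fun N F => ENNReal.ofReal
      (stageValue (H i) (m i) N F i * stageValue (H j) (m j) N F j * c N F))
    (fun N F G h => by
      simp only [stageValue_congr h i, stageValue_congr h j, hc, seen_congr h i, seen_congr h j])
    (by
      intro N F
      have hnn : ∀ o, 0 ≤ stageValue (H i) (m i) (N + 1) (Function.update F N o) i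
          * stageValue (H j) (m j) (N + 1) (Function.update F N o) j
          * c (N + 1) (Function.update F N o) := fun o =>
        mul_nonneg (mul_nonneg (hst0 _ _ _) (hst0 _ _ _)) (hc0 _ _)
      rw [lintegral_trialLaw_ofReal h0 h1 _ hnn]
      refine ENNReal.ofReal_le_ofReal ?_
      set f : Option ι → ℝ := fun o =>
        stageValue (H i) (m i) (N + 1) (Function.update F N o) i
          * stageValue (H j) (m j) (N + 1) (Function.update F N o) j
          * c (N + 1) (Function.update F N o) with hf
      have hother : ∀ k, k ≠ i ∧ k ≠ j → f (some k) = f none := by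
        rintro k ⟨hki, hkj⟩
        have aux : ∀ l, k ≠ l → stageValue (H l) (m l) (N + 1) (Function.update F N (some k)) l
            = stageValue (H l) (m l) (N + 1) (Function.update F N none) l := by
          intro l hl
          by_cases hs : Seen N F l
          · rw [stageValue_update_of_seen hs, stageValue_update_of_seen hs]
          · rw [stageValue_update_of_not_seen hs, stageValue_update_of_not_seen hs]
            simp [hl]
        simp only [hf, aux i hki, aux j hkj, hc, seen_succ_update]
        simp [hki, hkj]
      have hsum : (1 - ∑ k, ρ k) * f none + ∑ k, ρ k * f (some k)
          = f none + (ρ i * (f (some i) - f none) + ρ j * (f (some j) - f none)) := by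
        have : ∑ k, ρ k * (f (some k) - f none)
            = ρ i * (f (some i) - f none) + ρ j * (f (some j) - f none) :=
          Finset.sum_eq_add i j hij (fun k _ hk => by rw [hother k hk]; ring) (by simp) (by simp)
        rw [← this]
        simp only [mul_sub, Finset.sum_sub_distrib, ← Finset.sum_mul]
        ring
      change (1 - ∑ k, ρ k) * f none + ∑ k, ρ k * f (some k) ≤ _
      rw [hsum]
      by_cases hi : Seen N F i <;> by_cases hj : Seen N F j
      · simp only [hf, stageValue_update_of_seen hi, stageValue_update_of_seen hj, hc,
          seen_succ_update, hi, hj]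
        simp
      · simp only [hf, stageValue_update_of_seen hi, stageValue_update_of_not_seen hj, hc,
          seen_succ_update, hi, hj]
        have e : stageValue (H j) (m j) N F j = m j N := if_neg hj
        simp only [e, Option.some.injEq, hij, hrec j N]
        simp
        apply le_of_eq; ring
      · simp only [hf, stageValue_update_of_seen hj, stageValue_update_of_not_seen hi, hc,
          seen_succ_update, hi, hj]
        have e : stageValue (H i) (m i) N F i = m i N := if_neg hi
        simp only [e, Option.some.injEq, hij.symm, hrec i N]
        simp
        apply le_of_eq; ring
      · simp only [hf, stageValue_update_of_not_seen hj, stageValue_update_of_not_seen hi, hc,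
          seen_succ_update, hi, hj]
        have e : stageValue (H i) (m i) N F i = m i N := if_neg hi
        have e' : stageValue (H j) (m j) N F j = m j N := if_neg hj
        simp only [e, e', Option.some.injEq, hij.symm, hij]
        simp
        linarith [hstep N]) (fun _ => none)
  have hfin : ENNReal.ofReal (stageValue (H i) (m i) 0 (fun _ => none) i
        * stageValue (H j) (m j) 0 (fun _ => none) j * c 0 (fun _ => none))
      = ENNReal.ofReal (m i 0 * m j 0 * κ) := by simp [stageValue, Seen, hc]
  rw [← hfin]
  refine le_trans (lintegral_mono_ae ?_) key
  filter_upwards [ae_eventually_stageValue_eq h0 h1 hdeg, ae_seen h0 h1 hi0 hi1] with F hF hs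
  obtain ⟨M, k, hk, e⟩ := hs
  refine le_of_eq (Tendsto.liminf_eq ?_).symm
  refine tendsto_const_nhds.congr' ?_
  filter_upwards [hF, eventually_ge_atTop M] with N hN hMN
  have : Seen N F i := ⟨k, hk.trans_le hMN, e⟩
  simp [hN, hc, this]

end Stages

/-! ### Memorylessness and Laplace transform of the exponential law -/

section Exponential

instance : IsProbabilityMeasure (expMeasure 1) := isProbabilityMeasure_expMeasure one_pos

theorem lintegral_expMeasure_one {h : ℝ → ℝ≥0∞} (hh : Measurable h) :
    ∫⁻ z, h z ∂(expMeasure 1) = ∫⁻ z in Set.Ioi 0, ENNReal.ofReal (Real.exp (-z)) * h z := by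
  have hm : Measurable (exponentialPDF 1) := (measurable_exponentialPDFReal 1).ennreal_ofReal
  change ∫⁻ z, h z ∂(volume.withDensity (exponentialPDF 1)) = _
  rw [lintegral_withDensity_eq_lintegral_mul _ hm hh, ← lintegral_indicator measurableSet_Ioi]
  refine lintegral_congr_ae ?_
  filter_upwards [compl_mem_ae_iff.2 (measure_singleton (0 : ℝ))] with z hz
  have hz : z ≠ 0 := hz
  simp only [Pi.mul_apply, exponentialPDF_eq, Set.indicator_apply, Set.mem_Ioi]
  rcases lt_or_gt_of_ne hz with h | h
  · simp [h.not_ge, h.not_gt]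
  · simp [h.le, h]

theorem ae_expMeasure_one_pos : ∀ᵐ z ∂(expMeasure 1), 0 < z := by
  rw [ae_iff]
  have : MeasurableSet {z : ℝ | ¬ 0 < z} := by
    simp only [not_lt]; exact measurableSet_Iic
  rw [← lintegral_indicator_one this, lintegral_expMeasure_one (measurable_one.indicator this)]
  rw [setLIntegral_congr_fun (g := fun _ => 0) measurableSet_Ioi]
  · simp
  · intro z hz
    have hz : 0 < z := hz
    simp [hz]

theorem decayRate_pos {r : ℝ} (h0 : 0 < r) (h1 : r < 1) : 0 < decayRate r := by
  have := Real.log_neg (show 0 < 1 - r by linarith) (by linarith)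
  unfold decayRate; linarith

theorem exp_neg_decayRate {r : ℝ} (h1 : r < 1) : Real.exp (-decayRate r) = 1 - r := by
  rw [decayRate, neg_neg, Real.exp_log (by linarith)]

theorem measurable_auxDensity (r : ℝ) : Measurable fun s : ℝ =>
    ENNReal.ofReal (decayRate r * Real.exp (-(decayRate r) * s) / r) := by
  fun_prop

/-- The exponential law is the mixture of its restriction to `[0, α]` and its translate by `α`. -/
theorem lintegral_expMeasure_eq_add {r : ℝ} (h0 : 0 < r) (h1 : r < 1) {h : ℝ → ℝ≥0∞}
    (hh : Measurable h) :
    ∫⁻ z, h z ∂(expMeasure 1)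
      = ENNReal.ofReal r * ∫⁻ s, h (decayRate r * s) ∂(auxLaw r)
        + ENNReal.ofReal (1 - r) * ∫⁻ z, h (decayRate r + z) ∂(expMeasure 1) := by
  have hα := decayRate_pos h0 h1
  have hexp := exp_neg_decayRate h1
  set α := decayRate r with hαdef
  set g : ℝ → ℝ≥0∞ := fun z => ENNReal.ofReal (Real.exp (-z)) * h z with hg
  have hsplit : ∫⁻ z in Set.Ioi 0, g z = (∫⁻ z in Set.Ioc 0 α, g z) + ∫⁻ z in Set.Ioi α, g z := by
    rw [← Set.Ioc_union_Ioi_eq_Ioi hα.le]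
    exact lintegral_union measurableSet_Ioi (Set.Ioc_disjoint_Ioi le_rfl)
  have hfirst : ∫⁻ z in Set.Ioc 0 α, g z
      = ENNReal.ofReal r * ∫⁻ s, h (α * s) ∂(auxLaw r) := by
    have him : (fun s => α * s) '' Set.Ioc 0 1 = Set.Ioc 0 α := by
      rw [Set.image_mul_left_Ioc hα]; simp
    rw [← him, lintegral_image_eq_lintegral_abs_deriv_mul measurableSet_Ioc
      (f' := fun _ => α) (fun s _ => by simpa using ((hasDerivAt_id s).const_mul α).hasDerivWithinAt)
      (fun a _ b _ hab => mul_left_cancel₀ hα.ne' hab)]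
    have hhα : Measurable fun s => h (α * s) := hh.comp (measurable_const_mul α)
    rw [auxLaw, if_pos ⟨h0, h1⟩, lintegral_withDensity_eq_lintegral_mul _ (measurable_auxDensity r)
      hhα, ← lintegral_const_mul _ ((measurable_auxDensity r).mul hhα)]
    rw [setLIntegral_congr Ioc_ae_eq_Icc]
    refine lintegral_congr fun s => ?_
    simp only [Pi.mul_apply, hg]
    rw [← mul_assoc, ← mul_assoc, ← ENNReal.ofReal_mul (abs_nonneg _), ← ENNReal.ofReal_mul h0.le,
      abs_of_pos hα, ← hαdef, mul_div_cancel₀ _ h0.ne', neg_mul]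
  have hsecond : ∫⁻ z in Set.Ioi α, g z
      = ENNReal.ofReal (1 - r) * ∫⁻ z, h (α + z) ∂(expMeasure 1) := by
    have him : (fun s => α + s) '' Set.Ioi 0 = Set.Ioi α := by
      rw [Set.image_const_add_Ioi]; simp
    have hm : Measurable fun z => h (α + z) := hh.comp (measurable_const_add α)
    rw [← him, lintegral_image_eq_lintegral_abs_deriv_mul measurableSet_Ioi
      (f' := fun _ => 1) (fun s _ => by simpa using ((hasDerivAt_id s).const_add α).hasDerivWithinAt)
      (fun a _ b _ hab => add_left_cancel hab), lintegral_expMeasure_one hm,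
      ← lintegral_const_mul _ (by fun_prop)]
    refine lintegral_congr fun s => ?_
    simp only [hg, abs_one, ENNReal.ofReal_one, one_mul]
    rw [← mul_assoc, ← ENNReal.ofReal_mul (by linarith), neg_add, Real.exp_add, hexp]
  rw [lintegral_expMeasure_one hh, hsplit, hfirst, hsecond]

theorem isProbabilityMeasure_auxLaw (r : ℝ) : IsProbabilityMeasure (auxLaw r) := by
  by_cases hr : 0 < r ∧ r < 1
  · constructor
    -- With `h = 1` the splitting reads `1 = r * mass + (1 - r)`, which determines the mass without
    -- integrating the density.
    have := lintegral_expMeasure_eq_add hr.1 hr.2 (h := fun _ => 1) measurable_const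
    simp only [lintegral_const, measure_univ, mul_one, one_mul] at this
    have e : (1 : ℝ≥0∞) = ENNReal.ofReal r + ENNReal.ofReal (1 - r) := by
      rw [← ENNReal.ofReal_add hr.1.le (by linarith [hr.2])]; simp
    nth_rewrite 1 [e] at this
    have := (ENNReal.add_left_inj ENNReal.ofReal_ne_top).1 this
    have hne : ENNReal.ofReal r ≠ 0 := by simpa using hr.1
    nth_rewrite 1 [← mul_one (ENNReal.ofReal r)] at this
    exact ((ENNReal.mul_right_inj hne ENNReal.ofReal_ne_top).1 this).symm
  · rw [auxLaw, if_neg hr]; infer_instance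

instance (r : ℝ) : IsProbabilityMeasure (auxLaw r) := isProbabilityMeasure_auxLaw r

theorem ae_auxLaw_mem_Icc {r : ℝ} (hr : 0 < r ∧ r < 1) :
    ∀ᵐ s ∂(auxLaw r), s ∈ Set.Icc (0 : ℝ) 1 := by
  rw [auxLaw, if_pos hr]
  exact withDensity_absolutelyContinuous _ _ (ae_restrict_mem measurableSet_Icc)

/-- The expected value of `h` at an exponential variable whose trial count is `t`. -/
noncomputable def seenMean (r : ℝ) (h : ℝ → ℝ≥0∞) (t : ℕ) : ℝ≥0∞ :=
  ∫⁻ s, h (if 0 < r ∧ r < 1 then decayRate r * ((t : ℝ) + s) else s) ∂(auxLaw r)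

/-- The expected value of `h` at an exponential variable whose trial count is at least `N`. -/
noncomputable def pendingMean (r : ℝ) (h : ℝ → ℝ≥0∞) (N : ℕ) : ℝ≥0∞ :=
  ∫⁻ z, h ((if 0 < r ∧ r < 1 then decayRate r * (N : ℝ) else 0) + z) ∂(expMeasure 1)

variable {r : ℝ} {h : ℝ → ℝ≥0∞}

theorem pendingMean_zero : pendingMean r h 0 = ∫⁻ z, h z ∂(expMeasure 1) := by
  simp [pendingMean]

theorem seenMean_of_not (hr : ¬ (0 < r ∧ r < 1)) (t : ℕ) :
    seenMean r h t = ∫⁻ z, h z ∂(expMeasure 1) := by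
  simp only [seenMean, auxLaw, if_neg hr]

theorem pendingMean_of_not (hr : ¬ (0 < r ∧ r < 1)) (N : ℕ) :
    pendingMean r h N = ∫⁻ z, h z ∂(expMeasure 1) := by
  simp only [pendingMean, if_neg hr, zero_add]

/-- Memorylessness: conditionally on exceeding `α N`, the variable stops in the next block of length
`α` with probability `r`, just as trial `N` hits the index with probability `r`. -/
theorem pendingMean_eq (hr0 : 0 ≤ r) (hr1 : r ≤ 1) (hh : Measurable h) (N : ℕ) :
    pendingMean r h N = ENNReal.ofReal r * seenMean r h N
      + ENNReal.ofReal (1 - r) * pendingMean r h (N + 1) := by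
  by_cases hr : 0 < r ∧ r < 1
  · have := lintegral_expMeasure_eq_add hr.1 hr.2 (h := fun z => h (decayRate r * N + z))
      (hh.comp (measurable_const_add _))
    simp only [pendingMean, seenMean, if_pos hr]
    rw [this]
    push_cast
    simp only [mul_add, mul_one, add_assoc]
  · rw [pendingMean_of_not hr, pendingMean_of_not hr, seenMean_of_not hr, ← add_mul,
      ← ENNReal.ofReal_add hr0 (by linarith)]
    simp

theorem seenMean_le_one (h1 : ∀ z, h z ≤ 1) (t : ℕ) : seenMean r h t ≤ 1 :=
  (lintegral_mono fun _ => h1 _).trans (by simp)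

theorem pendingMean_le_one (h1 : ∀ z, h z ≤ 1) (t : ℕ) : pendingMean r h t ≤ 1 :=
  (lintegral_mono fun _ => h1 _).trans (by simp)

/-- For a rate in `(0,1)` the point `α (N + 1)` separates the two ranges: `α (N + s) ≤ α (N + 1) ≤ α
(N + 1) + z`. -/
theorem seenMean_le_pendingMean (hh : Monotone h) (N : ℕ) :
    seenMean r h N ≤ pendingMean r h (N + 1) := by
  by_cases hr : 0 < r ∧ r < 1
  · have hα := decayRate_pos hr.1 hr.2
    simp only [pendingMean, seenMean, if_pos hr]
    calc _ ≤ ∫⁻ _, h (decayRate r * ((N + 1 : ℕ) : ℝ)) ∂(auxLaw r) := by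
          refine lintegral_mono_ae ?_
          filter_upwards [ae_auxLaw_mem_Icc hr] with s hs
          refine hh (mul_le_mul_of_nonneg_left ?_ hα.le)
          push_cast; linarith [hs.2]
      _ = ∫⁻ _, h (decayRate r * ((N + 1 : ℕ) : ℝ)) ∂(expMeasure 1) := by simp
      _ ≤ _ := by
          refine lintegral_mono_ae ?_
          filter_upwards [ae_expMeasure_one_pos] with z hz
          exact hh (by linarith)
  · rw [pendingMean_of_not hr, seenMean_of_not hr]

theorem pendingMean_le_seenMean (hh : Antitone h) (N : ℕ) :
    pendingMean r h (N + 1) ≤ seenMean r h N := by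
  by_cases hr : 0 < r ∧ r < 1
  · have hα := decayRate_pos hr.1 hr.2
    simp only [pendingMean, seenMean, if_pos hr]
    calc _ ≤ ∫⁻ _, h (decayRate r * ((N + 1 : ℕ) : ℝ)) ∂(expMeasure 1) := by
          refine lintegral_mono_ae ?_
          filter_upwards [ae_expMeasure_one_pos] with z hz
          exact hh (by linarith)
      _ = ∫⁻ _, h (decayRate r * ((N + 1 : ℕ) : ℝ)) ∂(auxLaw r) := by simp
      _ ≤ _ := by
          refine lintegral_mono_ae ?_
          filter_upwards [ae_auxLaw_mem_Icc hr] with s hs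
          refine hh (mul_le_mul_of_nonneg_left ?_ hα.le)
          push_cast; linarith [hs.2]
  · rw [pendingMean_of_not hr, seenMean_of_not hr]

/-- The exponential tail, with negative thresholds clipped to `0`, where the bound is trivial. Only
this inequality is needed, since the exact marginals come from a counting argument. -/
theorem lintegral_expMeasure_indicator_le (c : ℝ) :
    ∫⁻ z, (Set.Ici c).indicator 1 z ∂(expMeasure 1) ≤ ENNReal.ofReal (Real.exp (-(max c 0))) := by
  rcases le_total c 0 with hc | hc
  · rw [lintegral_indicator_one measurableSet_Ici, max_eq_right hc]
    simpa using prob_le_one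
  rw [max_eq_left hc, lintegral_expMeasure_one (measurable_one.indicator measurableSet_Ici)]
  calc _ ≤ ∫⁻ z, ENNReal.ofReal (Real.exp (-z)) * (Set.Ici c).indicator 1 z :=
        setLIntegral_le_lintegral _ _
    _ = ∫⁻ z in Set.Ici c, ENNReal.ofReal (Real.exp (-z)) := by
        rw [← lintegral_indicator measurableSet_Ici]
        refine lintegral_congr fun z => ?_
        by_cases hz : z ∈ Set.Ici c <;> simp [hz]
    _ = ENNReal.ofReal (∫ z in Set.Ioi c, Real.exp (-z)) := by
        rw [← setLIntegral_congr Ioi_ae_eq_Ici]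
        exact (ofReal_integral_eq_lintegral_ofReal (integrableOn_exp_neg_Ioi c)
          (ae_of_all _ fun z => (Real.exp_pos _).le)).symm
    _ ≤ _ := by rw [integral_exp_neg_Ioi]

/-- The Laplace transform of the exponential law. -/
theorem lintegral_expMeasure_exp {s : ℝ} (hs : 0 ≤ s) :
    ∫⁻ z, ENNReal.ofReal (Real.exp (-(s * z))) ∂(expMeasure 1) = ENNReal.ofReal (1 / (1 + s)) := by
  rw [lintegral_expMeasure_one (by fun_prop)]
  have hneg : -(1 + s) < 0 := by linarith
  calc _ = ∫⁻ z in Set.Ioi 0, ENNReal.ofReal (Real.exp (-(1 + s) * z)) := by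
        refine lintegral_congr fun z => ?_
        rw [← ENNReal.ofReal_mul (Real.exp_pos _).le, ← Real.exp_add]
        ring_nf
    _ = ENNReal.ofReal (∫ z in Set.Ioi 0, Real.exp (-(1 + s) * z)) :=
        (ofReal_integral_eq_lintegral_ofReal (integrableOn_exp_mul_Ioi hneg 0)
          (ae_of_all _ fun z => (Real.exp_pos _).le)).symm
    _ = _ := by
        rw [integral_exp_mul_Ioi hneg, mul_zero, Real.exp_zero, neg_div_neg_eq]

theorem toReal_pendingMean_eq (hr0 : 0 ≤ r) (hr1 : r ≤ 1) (hh : Measurable h)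
    (hle : ∀ z, h z ≤ 1) (N : ℕ) :
    (pendingMean r h N).toReal = r * (seenMean r h N).toReal
      + (1 - r) * (pendingMean r h (N + 1)).toReal := by
  have hs : seenMean r h N ≠ ⊤ := ne_top_of_le_ne_top ENNReal.one_ne_top (seenMean_le_one hle N)
  have hp : pendingMean r h (N + 1) ≠ ⊤ :=
    ne_top_of_le_ne_top ENNReal.one_ne_top (pendingMean_le_one hle _)
  rw [pendingMean_eq hr0 hr1 hh, ENNReal.toReal_add (ENNReal.mul_ne_top ENNReal.ofReal_ne_top hs)
    (ENNReal.mul_ne_top ENNReal.ofReal_ne_top hp), ENNReal.toReal_mul, ENNReal.toReal_mul,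
    ENNReal.toReal_ofReal hr0, ENNReal.toReal_ofReal (by linarith)]

/-- The decreasing exponential `e^{-s z}`, truncated to `1` on the negative axis. -/
noncomputable def expDecay (s z : ℝ) : ℝ≥0∞ := ENNReal.ofReal (Real.exp (-(s * max z 0)))

theorem measurable_expDecay (s : ℝ) : Measurable (expDecay s) := by
  unfold expDecay; fun_prop

theorem expDecay_le_one {s : ℝ} (hs : 0 ≤ s) (z : ℝ) : expDecay s z ≤ 1 := by
  rw [expDecay, ENNReal.ofReal_le_one, Real.exp_le_one_iff]
  have := mul_nonneg hs (le_max_right z 0)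
  linarith

/-- The shift by `decayRate r * N` factors out of the exponential. The resulting geometric
dependence on `N` is what allows a constant `κ` in the two-index problem. -/
theorem pendingMean_expDecay {r s : ℝ} (hr : 0 < r ∧ r < 1) (hs : 0 ≤ s) (N : ℕ) :
    (pendingMean r (expDecay s) N).toReal
      = Real.exp (-(s * decayRate r)) ^ N * (1 / (1 + s)) := by
  have hα := decayRate_pos hr.1 hr.2
  have : pendingMean r (expDecay s) N
      = ENNReal.ofReal (Real.exp (-(s * decayRate r)) ^ N * (1 / (1 + s))) := by
    rw [ENNReal.ofReal_mul (by positivity), ← lintegral_expMeasure_exp hs,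
      ← lintegral_const_mul _ (by fun_prop)]
    refine lintegral_congr_ae ?_
    filter_upwards [ae_expMeasure_one_pos] with z hz
    rw [if_pos hr, expDecay, max_eq_left (by positivity), ← ENNReal.ofReal_mul (by positivity),
      ← Real.exp_nat_mul, ← Real.exp_add]
    ring_nf
  rw [this, ENNReal.toReal_ofReal (by positivity)]

theorem lintegral_expDecay {s : ℝ} (hs : 0 ≤ s) :
    ∫⁻ z, expDecay s z ∂(expMeasure 1) = ENNReal.ofReal (1 / (1 + s)) := by
  rw [← lintegral_expMeasure_exp hs]
  refine lintegral_congr_ae ?_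
  filter_upwards [ae_expMeasure_one_pos] with z hz
  rw [expDecay, max_eq_left hz.le]

end Exponential

/-! ### The range of `Φ` -/

section Phi

theorem one_le_one_sub_rpow {x r : ℝ} (hx : x ∈ Set.Ioo (0 : ℝ) 1) (hr : r ∈ Set.Ioo (0 : ℝ) 1) :
    1 ≤ (1 - r) ^ (1 - 1 / x) := by
  have := one_le_one_div hx.1 hx.2.le
  exact Real.one_le_rpow_of_pos_of_le_one_of_nonpos (by linarith [hr.2]) (by linarith [hr.1])
    (by linarith)

theorem Phi_denominator_pos {x y r t : ℝ} (hx : x ∈ Set.Ioo (0 : ℝ) 1)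
    (hy : y ∈ Set.Ioo (0 : ℝ) 1) (hr : r ∈ Set.Ioo (0 : ℝ) 1) (ht : t ∈ Set.Ioo (0 : ℝ) 1) :
    0 < (1 - r) ^ (1 - 1 / x) * (1 - t) ^ (1 - 1 / y) + r + t - 1 := by
  nlinarith [one_le_one_sub_rpow hx hr, one_le_one_sub_rpow hy ht, hr.1, ht.1]

theorem Phi_mem_Icc (x y r t : ℝ) : Phi x y r t ∈ Set.Icc (0 : ℝ) 1 := by
  unfold Phi
  split_ifs with h
  · obtain ⟨hx, hy, hr, ht⟩ := h
    have h1 := one_le_one_sub_rpow hx hr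
    have h2 := one_le_one_sub_rpow hy ht
    have hd := Phi_denominator_pos hx hy hr ht
    refine ⟨div_nonneg (mul_nonneg (by linarith) (by linarith)) hd.le, (div_le_one hd).2 ?_⟩
    -- With `Q, P ≥ 1` the two powers, `(Q - 1)(P - 1) ≤ Q P + r + t - 1` amounts to `2 - r - t ≤ Q
    -- + P`.
    nlinarith [hr.1, ht.1]
  · simp

end Phi

/-! ### Negative dependence of the correlated exponentials -/

section Correlated

variable {ι : Type*}

theorem measurable_exponentialOf (ρ : ι → ℝ) :
    Measurable fun ω : (ι → ℕ) × (ι → ℝ) => exponentialOf ρ ω.1 ω.2 := by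
  refine measurable_pi_lambda _ fun i => ?_
  unfold exponentialOf
  split_ifs
  · have : Measurable fun n : ℕ => (n : ℝ) := measurable_of_countable _
    exact ((this.comp ((measurable_pi_apply i).comp measurable_fst)).add
      ((measurable_pi_apply i).comp measurable_snd)).const_mul _
  · exact (measurable_pi_apply i).comp measurable_snd

variable [Fintype ι] {ρ : ι → ℝ}

theorem isProbabilityMeasure_multivariateGeometric (h0 : ∀ i, 0 ≤ ρ i) (h1 : ∑ i, ρ i ≤ 1) :
    IsProbabilityMeasure (multivariateGeometric ρ) := by
  have := isProbabilityMeasure_trialLaw h0 h1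
  exact Measure.isProbabilityMeasure_map measurable_waitingTime.aemeasurable

theorem isProbabilityMeasure_correlatedExponential (h0 : ∀ i, 0 ≤ ρ i) (h1 : ∑ i, ρ i ≤ 1) :
    IsProbabilityMeasure (correlatedExponential ρ) := by
  have := isProbabilityMeasure_multivariateGeometric h0 h1
  exact Measure.isProbabilityMeasure_map (measurable_exponentialOf ρ).aemeasurable

/-- Integration of a product over the coordinates, with the auxiliary variables integrated out. -/
theorem lintegral_correlatedExponential_prod (h0 : ∀ i, 0 ≤ ρ i) (h1 : ∑ i, ρ i ≤ 1)
    {h : ι → ℝ → ℝ≥0∞} (hh : ∀ i, Measurable (h i)) :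
    ∫⁻ z, ∏ i, h i (z i) ∂(correlatedExponential ρ)
      = ∫⁻ F, ∏ i, seenMean (ρ i) (h i) (waitingTime F i)
          ∂(Measure.infinitePi fun _ : ℕ => trialLaw ρ) := by
  have := isProbabilityMeasure_trialLaw h0 h1
  have := isProbabilityMeasure_multivariateGeometric h0 h1
  have hm : Measurable fun z : ι → ℝ => ∏ i, h i (z i) :=
    Finset.measurable_fun_prod _ fun i _ => (hh i).comp (measurable_pi_apply i)
  rw [correlatedExponential, lintegral_map hm (measurable_exponentialOf ρ),
    lintegral_prod (fun ω => ∏ i, h i (exponentialOf ρ ω.1 ω.2 i))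
      (hm.comp (measurable_exponentialOf ρ)).aemeasurable, multivariateGeometric,
    lintegral_map (measurable_of_countable _) measurable_waitingTime]
  refine lintegral_congr fun F => ?_
  refine lintegral_pi_prod (fun i => auxLaw (ρ i)) (fun i s => h i (if 0 < ρ i ∧ ρ i < 1 then
    decayRate (ρ i) * ((waitingTime F i : ℝ) + s) else s)) fun i => (hh i).comp ?_
  split_ifs <;> fun_prop

/-- The coordinates of `CorrelatedExponential` are negatively dependent exponential variables. -/
theorem lintegral_correlatedExponential_prod_le (h0 : ∀ i, 0 ≤ ρ i) (h1 : ∑ i, ρ i ≤ 1)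
    {h : ι → ℝ → ℝ≥0∞} (hle : ∀ i z, h i z ≤ 1)
    (hmono : (∀ i, Monotone (h i)) ∨ ∀ i, Antitone (h i)) :
    ∫⁻ z, ∏ i, h i (z i) ∂(correlatedExponential ρ)
      ≤ ∏ i, ∫⁻ z, h i z ∂(expMeasure 1) := by
  have hh : ∀ i, Measurable (h i) := fun i =>
    hmono.elim (fun H => (H i).measurable) (fun H => (H i).measurable)
  have hρ1 : ∀ i, ρ i ≤ 1 := fun i =>
    (Finset.single_le_sum (fun j _ => h0 j) (Finset.mem_univ i)).trans h1
  have hs : ∀ i t, seenMean (ρ i) (h i) t ≠ ⊤ := fun i t =>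
    ne_top_of_le_ne_top ENNReal.one_ne_top (seenMean_le_one (hle i) t)
  have hp : ∀ i t, pendingMean (ρ i) (h i) t ≠ ⊤ := fun i t =>
    ne_top_of_le_ne_top ENNReal.one_ne_top (pendingMean_le_one (hle i) t)
  have key := lintegral_prod_payoff_le h0 h1
    (H := fun i t => (seenMean (ρ i) (h i) t).toReal)
    (m := fun i t => (pendingMean (ρ i) (h i) t).toReal)
    (fun _ _ => ENNReal.toReal_nonneg) (fun _ _ => ENNReal.toReal_nonneg)
    (fun i N => toReal_pendingMean_eq (h0 i) (hρ1 i) (hh i) (hle i) N)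
    (fun i => by
      by_cases hr : 0 < ρ i ∧ ρ i < 1
      · exact .inl hr
      · exact .inr fun N t => by rw [pendingMean_of_not hr, seenMean_of_not hr])
    (fun N i j => by
      rcases hmono with H | H
      · exact mul_nonneg_of_nonpos_of_nonpos
          (sub_nonpos.2 (ENNReal.toReal_mono (hp _ _) (seenMean_le_pendingMean (H i) N)))
          (sub_nonpos.2 (ENNReal.toReal_mono (hp _ _) (seenMean_le_pendingMean (H j) N)))
      · exact mul_nonneg
          (sub_nonneg.2 (ENNReal.toReal_mono (hs _ _) (pendingMean_le_seenMean (H i) N)))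
          (sub_nonneg.2 (ENNReal.toReal_mono (hs _ _) (pendingMean_le_seenMean (H j) N))))
  simp only [ENNReal.ofReal_prod_of_nonneg fun i _ => ENNReal.toReal_nonneg,
    ENNReal.ofReal_toReal (hs _ _), ENNReal.ofReal_toReal (hp _ _)] at key
  simp only [pendingMean_zero] at key
  rw [lintegral_correlatedExponential_prod h0 h1 hh]
  exact key

/-- The joint Laplace transform of two coordinates of `CorrelatedExponential`, evaluated at the
points `1 / x - 1` and `1 / y - 1`. -/
theorem lintegral_correlatedExponential_pair_le (h0 : ∀ i, 0 ≤ ρ i) (h1 : ∑ i, ρ i ≤ 1)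
    {i j : ι} (hij : i ≠ j) (hi : ρ i ∈ Set.Ioo (0 : ℝ) 1) (hj : ρ j ∈ Set.Ioo (0 : ℝ) 1)
    {x y : ℝ} (hx : x ∈ Set.Ioo (0 : ℝ) 1) (hy : y ∈ Set.Ioo (0 : ℝ) 1) :
    ∫⁻ z, expDecay (1 / x - 1) (z i) * expDecay (1 / y - 1) (z j) ∂(correlatedExponential ρ)
      ≤ ENNReal.ofReal (x * y * (1 - Phi x y (ρ i) (ρ j))) := by
  classical
  have hρ1 : ∀ i, ρ i ≤ 1 := fun i =>
    (Finset.single_le_sum (fun j _ => h0 j) (Finset.mem_univ i)).trans h1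
  have hsx : 0 ≤ 1 / x - 1 := by
    have := one_le_one_div hx.1 hx.2.le; linarith
  have hsy : 0 ≤ 1 / y - 1 := by
    have := one_le_one_div hy.1 hy.2.le; linarith
  -- The constant `1` at the remaining indices turns the pair into a product over all coordinates.
  set h : ι → ℝ → ℝ≥0∞ := fun k => if k = i then expDecay (1 / x - 1) else
    if k = j then expDecay (1 / y - 1) else fun _ => 1 with hdef
  have hhi : h i = expDecay (1 / x - 1) := by simp [hdef]
  have hhj : h j = expDecay (1 / y - 1) := by simp [hdef, hij.symm]
  have hho : ∀ k, k ≠ i ∧ k ≠ j → h k = fun _ => 1 := fun k hk => by simp [hdef, hk.1, hk.2]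
  have hh : ∀ k, Measurable (h k) := by
    intro k; simp only [hdef]; split_ifs
    exacts [measurable_expDecay _, measurable_expDecay _, measurable_const]
  have hle : ∀ k z, h k z ≤ 1 := by
    intro k z; simp only [hdef]; split_ifs
    exacts [expDecay_le_one hsx z, expDecay_le_one hsy z, le_rfl]
  have hs : ∀ i t, seenMean (ρ i) (h i) t ≠ ⊤ := fun i t =>
    ne_top_of_le_ne_top ENNReal.one_ne_top (seenMean_le_one (hle i) t)
  have hrec := fun k N => toReal_pendingMean_eq (h0 k) (hρ1 k) (hh k) (hle k) N
  have hmi := fun N => pendingMean_expDecay hi hsx N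
  have hmj := fun N => pendingMean_expDecay hj hsy N
  rw [← hhi] at hmi
  rw [← hhj] at hmj
  have hΦ := Phi_mem_Icc x y (ρ i) (ρ j)
  have hQi : Real.exp (-((1 / x - 1) * decayRate (ρ i))) * (1 - ρ i) ^ (1 - 1 / x) = 1 := by
    rw [Real.rpow_def_of_pos (by linarith [hi.2]), ← Real.exp_add, decayRate, Real.exp_eq_one_iff]
    ring
  have hQj : Real.exp (-((1 / y - 1) * decayRate (ρ j))) * (1 - ρ j) ^ (1 - 1 / y) = 1 := by
    rw [Real.rpow_def_of_pos (by linarith [hj.2]), ← Real.exp_add, decayRate, Real.exp_eq_one_iff]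
    ring
  -- The one-trial equation for `κ = 1 - Φ`, divided by `q p`, where `q` and `p` are the one-step
  -- decay factors and the two powers are their inverses.
  have hκ : (1 - ρ i) ^ (1 - 1 / x) + (1 - ρ j) ^ (1 - 1 / y) - (2 - ρ i - ρ j)
      + (1 - ρ i - ρ j) * (1 - Phi x y (ρ i) (ρ j))
      = (1 - ρ i) ^ (1 - 1 / x) * (1 - ρ j) ^ (1 - 1 / y) * (1 - Phi x y (ρ i) (ρ j)) := by
    have hd := Phi_denominator_pos hx hy hi hj
    rw [Phi, if_pos ⟨hx, hy, hi, hj⟩]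
    field_simp
    ring
  set q := Real.exp (-((1 / x - 1) * decayRate (ρ i)))
  set p := Real.exp (-((1 / y - 1) * decayRate (ρ j)))
  set Q := (1 - ρ i) ^ (1 - 1 / x)
  set P := (1 - ρ j) ^ (1 - 1 / y)
  set κ := 1 - Phi x y (ρ i) (ρ j)
  have hκ' : q + p - (2 - ρ i - ρ j) * (q * p) + (1 - ρ i - ρ j) * (q * p) * κ = κ := by
    have e : (q * p) * (Q + P - (2 - ρ i - ρ j) + (1 - ρ i - ρ j) * κ)
        = (q * p) * (Q * P * κ) := by rw [hκ]
    have e1 : (q * p) * (Q * P * κ) = (q * Q) * (p * P) * κ := by ring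
    have e2 : (q * p) * (Q + P - (2 - ρ i - ρ j) + (1 - ρ i - ρ j) * κ)
        = (q * Q) * p + (p * P) * q - (2 - ρ i - ρ j) * (q * p)
          + (1 - ρ i - ρ j) * (q * p) * κ := by ring
    rw [e1, e2, hQi, hQj] at e
    linarith
  have key := lintegral_payoff_pair_le h0 h1
    (H := fun i t => (seenMean (ρ i) (h i) t).toReal)
    (m := fun i t => (pendingMean (ρ i) (h i) t).toReal)
    (fun _ _ => ENNReal.toReal_nonneg) (fun _ _ => ENNReal.toReal_nonneg)
    (fun i => by
      by_cases hr : 0 < ρ i ∧ ρ i < 1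
      · exact .inl hr
      · exact .inr fun N t => by rw [pendingMean_of_not hr, seenMean_of_not hr])
    hrec hij hi.1 hi.2 (κ := κ) (sub_nonneg.2 hΦ.2) (by
      intro N
      have ei := hrec i N
      have ej := hrec j N
      rw [hmi, hmi] at ei
      rw [hmj, hmj] at ej
      -- The recursion expresses the payoff through the geometric pending values, so `seenMean`
      -- never has to be computed.
      have ei' : ρ i * (seenMean (ρ i) (h i) N).toReal
          = q ^ N * (1 / (1 + (1 / x - 1))) - (1 - ρ i) * (q ^ (N + 1) * (1 / (1 + (1 / x - 1)))) := by
        linarith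
      have ej' : ρ j * (seenMean (ρ j) (h j) N).toReal
          = p ^ N * (1 / (1 + (1 / y - 1))) - (1 - ρ j) * (p ^ (N + 1) * (1 / (1 + (1 / y - 1)))) := by
        linarith
      simp only [hmi, hmj]
      rw [← mul_assoc (ρ i), ei', mul_left_comm (ρ j), ej']
      generalize (1 / (1 + (1 / x - 1))) = X
      generalize (1 / (1 + (1 / y - 1))) = Y
      apply le_of_eq
      calc _ = q ^ N * p ^ N * X * Y *
            (q + p - (2 - ρ i - ρ j) * (q * p) + (1 - ρ i - ρ j) * (q * p) * κ) := by ring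
        _ = _ := by rw [hκ']; ring)
  have hL : ∀ F : ℕ → Option ι, ∏ k, seenMean (ρ k) (h k) (waitingTime F k)
      = ENNReal.ofReal ((seenMean (ρ i) (h i) (waitingTime F i)).toReal
        * (seenMean (ρ j) (h j) (waitingTime F j)).toReal) := by
    intro F
    rw [Finset.prod_eq_mul i j hij (fun k _ hk => by rw [hho k hk]; simp [seenMean]) (by simp)
      (by simp), ENNReal.ofReal_mul ENNReal.toReal_nonneg, ENNReal.ofReal_toReal (hs _ _),
      ENNReal.ofReal_toReal (hs _ _)]
  have hR : ∀ z : ι → ℝ, ∏ k, h k (z k)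
      = expDecay (1 / x - 1) (z i) * expDecay (1 / y - 1) (z j) := by
    intro z
    rw [Finset.prod_eq_mul i j hij (fun k _ hk => by rw [hho k hk]) (by simp) (by simp), hhi, hhj]
  simp only [← hR]
  rw [lintegral_correlatedExponential_prod h0 h1 hh]
  simp only [hL]
  refine key.trans (le_of_eq ?_)
  rw [hmi, hmj]
  congr 1
  have := hx.1.ne'
  have := hy.1.ne'
  have ex : 1 / (1 + (1 / x - 1)) = x := by field_simp; ring
  have ey : 1 / (1 + (1 / y - 1)) = y := by field_simp; ring
  rw [ex, ey]; ring

end Correlated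

/-! ### The race at one right-node and the replacement of rows -/

section Marginals

variable {U V : Type*}

/-- The indicator of the event that the index `σ` minimizes `y / w` over `A`. -/
noncomputable def minIndicator (A : Finset U) (w : U → ℝ) (σ : U) (y : U → ℝ) : ℝ≥0∞ :=
  open Classical in if ∀ u ∈ A, y σ / w σ ≤ y u / w u then 1 else 0

variable {A : Finset U} {w : U → ℝ} {σ : U}

theorem minIndicator_le_one (y : U → ℝ) : minIndicator A w σ y ≤ 1 := by
  unfold minIndicator; split_ifs <;> simp

theorem minIndicator_mono {y y' : U → ℝ}
    (h : (∀ u ∈ A, y σ / w σ ≤ y u / w u) → ∀ u ∈ A, y' σ / w σ ≤ y' u / w u) :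
    minIndicator A w σ y ≤ minIndicator A w σ y' := by
  unfold minIndicator
  by_cases h1 : ∀ u ∈ A, y σ / w σ ≤ y u / w u
  · rw [if_pos h1, if_pos (h h1)]
  · rw [if_neg h1]; exact zero_le

theorem measurable_minIndicator : Measurable (minIndicator A w σ) := by
  classical
  refine Measurable.ite ?_ measurable_const measurable_const
  have : {y : U → ℝ | ∀ u ∈ A, y σ / w σ ≤ y u / w u}
      = ⋂ u ∈ A, {y : U → ℝ | y σ / w σ ≤ y u / w u} := by ext; simp
  rw [this]
  refine Finset.measurableSet_biInter _ fun u _ => measurableSet_le ?_ ?_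
  · exact (measurable_pi_apply σ).div_const _
  · exact (measurable_pi_apply u).div_const _

variable [DecidableEq U]

/-- The coordinate `u` is not integrated, so the inequality holds pointwise under the integral. Row
replacement needs this to retain monotonicity after other rows have been averaged out. -/
theorem monotone_lmarginal_update {ν : U → Measure ℝ} [∀ u, SigmaFinite (ν u)]
    {s : Finset U} {φ : (U → ℝ) → ℝ≥0∞} {u : U}
    (hu : u ∉ s) (hφ : Measurable φ) (h : ∀ y, Monotone fun t => φ (Function.update y u t))
    (y : U → ℝ) : Monotone fun t => (∫⋯∫⁻_s, φ ∂ν) (Function.update y u t) := by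
  intro t t' htt'
  change (∫⋯∫⁻_s, φ ∂ν) _ ≤ (∫⋯∫⁻_s, φ ∂ν) _
  rw [lmarginal_update_of_notMem hφ hu, lmarginal_update_of_notMem hφ hu]
  exact lmarginal_mono (fun w => h w htt') y

theorem antitone_lmarginal_update {ν : U → Measure ℝ} [∀ u, SigmaFinite (ν u)]
    {s : Finset U} {φ : (U → ℝ) → ℝ≥0∞} {u : U}
    (hu : u ∉ s) (hφ : Measurable φ) (h : ∀ y, Antitone fun t => φ (Function.update y u t))
    (y : U → ℝ) : Antitone fun t => (∫⋯∫⁻_s, φ ∂ν) (Function.update y u t) := by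
  intro t t' htt'
  change (∫⋯∫⁻_s, φ ∂ν) _ ≤ (∫⋯∫⁻_s, φ ∂ν) _
  rw [lmarginal_update_of_notMem hφ hu, lmarginal_update_of_notMem hφ hu]
  exact lmarginal_mono (fun w => h w htt') y

/-- If each row law `μ u` is negatively dependent for monotone and for antitone functions, then
rows can be replaced by independent exponential variables in the integral of a product over the
columns, provided that in each replaced row the factors vary in the same direction. -/
theorem lmarginal_prod_le [Fintype V] (μ : U → Measure (V → ℝ))
    [∀ u, IsProbabilityMeasure (μ u)]
    (hμ : ∀ u (h : V → ℝ → ℝ≥0∞), (∀ v z, h v z ≤ 1) →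
      ((∀ v, Monotone (h v)) ∨ ∀ v, Antitone (h v)) →
      ∫⁻ z, ∏ v, h v (z v) ∂(μ u) ≤ ∏ v, ∫⁻ z, h v z ∂(expMeasure 1))
    (φ : V → (U → ℝ) → ℝ≥0∞) (hφ : ∀ v, Measurable (φ v)) (hφ1 : ∀ v y, φ v y ≤ 1)
    (s : Finset U)
    (hmono : ∀ u ∈ s, (∀ v y, Monotone fun t => φ v (Function.update y u t)) ∨
      ∀ v y, Antitone fun t => φ v (Function.update y u t)) (z : U → V → ℝ) :
    (∫⋯∫⁻_s, (fun z => ∏ v, φ v (fun u => z u v)) ∂μ) z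
      ≤ ∏ v, (∫⋯∫⁻_s, φ v ∂(fun _ => expMeasure 1)) (fun u => z u v) := by
  have hprod : Measurable fun z : U → V → ℝ => ∏ v, φ v (fun u => z u v) := by
    refine Finset.measurable_fun_prod _ fun v _ => (hφ v).comp ?_
    exact measurable_pi_lambda _ fun u => (measurable_pi_apply v).comp (measurable_pi_apply u)
  induction s using Finset.induction_on generalizing z with
  | empty => simp
  | insert u s hu ih =>
    have ih := ih fun u' hu' => hmono u' (Finset.mem_insert_of_mem hu')
    -- Row `u` is integrated outermost: the rows in `s` are already decoupled by induction, leaving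
    -- a product of functions of the separate entries of row `u`, to which `hμ` applies.
    rw [lmarginal_insert _ hprod hu]
    have hcol : ∀ (w : V → ℝ) v, (fun u' => Function.update z u w u' v)
        = Function.update (fun u' => z u' v) u (w v) := by
      intro w v
      funext u'
      by_cases h : u' = u
      · subst h; simp
      · simp [h]
    calc _ ≤ ∫⁻ w, ∏ v, (∫⋯∫⁻_s, φ v ∂(fun _ => expMeasure 1))
          (Function.update (fun u' => z u' v) u (w v)) ∂(μ u) := by
          refine lintegral_mono fun w => (ih _).trans (le_of_eq ?_)
          simp only [hcol]
      _ ≤ ∏ v, ∫⁻ t, (∫⋯∫⁻_s, φ v ∂(fun _ => expMeasure 1))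
          (Function.update (fun u' => z u' v) u t) ∂(expMeasure 1) := by
          refine hμ u (fun v t => (∫⋯∫⁻_s, φ v ∂(fun _ => expMeasure 1))
            (Function.update (fun u' => z u' v) u t)) (fun v t => ?_) ?_
          · exact (lintegral_mono fun _ => hφ1 v _).trans (by simp)
          · refine (hmono u (Finset.mem_insert_self _ _)).imp (fun H v => ?_) (fun H v => ?_)
            · exact monotone_lmarginal_update hu (hφ v) (H v) _
            · exact antitone_lmarginal_update hu (hφ v) (H v) _
      _ = _ := by
          refine Finset.prod_congr rfl fun v _ => ?_
          rw [lmarginal_insert _ (hφ v) hu]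

theorem monotone_minIndicator_update {u : U} (hu : u ≠ σ) (hw : 0 ≤ w u) (y : U → ℝ) :
    Monotone fun t => minIndicator A w σ (Function.update y u t) := by
  intro t t' htt'
  refine minIndicator_mono fun h a ha => (le_of_eq ?_).trans ((h a ha).trans ?_)
  · simp [hu.symm]
  · by_cases hau : a = u
    · subst hau; simpa using div_le_div_of_nonneg_right htt' hw
    · simp [hau]

theorem antitone_minIndicator_update (hw : 0 ≤ w σ) (y : U → ℝ) :
    Antitone fun t => minIndicator A w σ (Function.update y σ t) := by
  intro t t' htt'
  refine minIndicator_mono fun h a ha => ?_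
  by_cases hau : a = σ
  · subst hau; exact le_rfl
  · have := h a ha
    simp only [Function.update_self, Function.update_of_ne hau] at this ⊢
    exact (div_le_div_of_nonneg_right htt' hw).trans this

/-- A left-node that does not compete at the right-node has no influence there; stability is used
through this fact. -/
theorem minIndicator_update_of_notMem {u : U} (hu : u ≠ σ) (huA : u ∉ A) (y : U → ℝ) (t : ℝ) :
    minIndicator A w σ (Function.update y u t) = minIndicator A w σ y := by
  have hne : ∀ a ∈ A, a ≠ u := fun a ha h => huA (h ▸ ha)
  refine le_antisymm (minIndicator_mono fun h a ha => ?_) (minIndicator_mono fun h a ha => ?_)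
  · have := h a ha
    rwa [Function.update_of_ne hu.symm, Function.update_of_ne (hne a ha)] at this
  · rw [Function.update_of_ne hu.symm, Function.update_of_ne (hne a ha)]
    exact h a ha

/-- The probability that `σ` wins, given its own exponential variable. -/
theorem lmarginal_minIndicator_le [Fintype U] (hσ : σ ∈ A) (hw : ∀ u ∈ A, 0 < w u)
    (hsum : ∑ u ∈ A, w u = 1) (y : U → ℝ) :
    (∫⋯∫⁻_(Finset.erase Finset.univ σ), minIndicator A w σ ∂(fun _ => expMeasure 1)) y
      ≤ expDecay (1 / w σ - 1) (y σ) := by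
  -- The least value of `y u` with which `u` does not beat `σ`.
  set c : U → ℝ := fun u => w u * (y σ / w σ) with hc
  set g : U → ℝ → ℝ≥0∞ := fun u => if u ∈ A then (Set.Ici (c u)).indicator 1 else 1 with hg
  have hgm : ∀ u, Measurable (g u) := by
    intro u; simp only [hg]; split_ifs
    exacts [measurable_one.indicator measurableSet_Ici, measurable_one]
  calc _ ≤ ∫⁻ b : (↥(Finset.univ.erase σ) → ℝ),
        ∏ u : ↥(Finset.univ.erase σ), g u (b u)
        ∂(Measure.pi fun _ => expMeasure 1) := by
        refine lintegral_mono fun b => ?_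
        have hσb : Function.updateFinset y (Finset.univ.erase σ) b σ = y σ := by
          simp [Function.updateFinset]
        have hub : ∀ u : ↥(Finset.univ.erase σ),
            Function.updateFinset y (Finset.univ.erase σ) b u = b u := by
          intro u
          simp [Function.updateFinset, -Finset.mem_erase, u.2]
        unfold minIndicator
        split_ifs with h
        · refine le_of_eq (Finset.prod_eq_one fun u _ => ?_).symm
          simp only [hg]
          split_ifs with hu
          · rw [Set.indicator_of_mem]
            · rfl
            · have := h u hu
              rw [hσb, hub, le_div_iff₀ (hw u hu)] at this
              exact (mul_comm _ _).trans_le this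
          · rfl
        · exact zero_le
    _ = ∏ u : ↥(Finset.univ.erase σ), ∫⁻ t, g u t ∂(expMeasure 1) :=
        lintegral_pi_prod (fun _ => expMeasure 1) (fun u : ↥(Finset.univ.erase σ) => g u)
          (fun u => hgm u)
    _ = ∏ u ∈ Finset.univ.erase σ, ∫⁻ t, g u t ∂(expMeasure 1) :=
        Finset.prod_coe_sort _ (fun u => ∫⁻ t, g u t ∂(expMeasure 1))
    _ ≤ ∏ u ∈ Finset.univ.erase σ,
          (if u ∈ A then ENNReal.ofReal (Real.exp (-(max (c u) 0))) else 1) := by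
        refine Finset.prod_le_prod' fun u _ => ?_
        simp only [hg]
        split_ifs with hu
        · exact lintegral_expMeasure_indicator_le _
        · simp
    _ = ∏ u ∈ A.erase σ, ENNReal.ofReal (Real.exp (-(max (c u) 0))) := by
        rw [Finset.prod_ite, Finset.prod_const_one, mul_one]
        refine Finset.prod_congr ?_ fun _ _ => rfl
        ext u; simp [and_comm]
    _ = expDecay (1 / w σ - 1) (y σ) := by
        rw [expDecay, ← ENNReal.ofReal_prod_of_nonneg (fun _ _ => (Real.exp_pos _).le),
          ← Real.exp_sum, Finset.sum_neg_distrib]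
        congr 3
        -- The clipped thresholds are proportional to the weights, so over the rivals they sum to
        -- `(1 - w σ) * max (y σ) 0 / w σ`.
        have hmax : ∀ u ∈ A.erase σ, max (c u) 0 = w u * (max (y σ) 0 / w σ) := by
          intro u hu
          have hwu := hw u (Finset.mem_of_mem_erase hu)
          have hwσ := hw σ hσ
          rcases le_total (y σ) 0 with h | h
          · rw [max_eq_right h, max_eq_right]
            · simp
            · exact mul_nonpos_of_nonneg_of_nonpos hwu.le (div_nonpos_of_nonpos_of_nonneg h hwσ.le)
          · rw [max_eq_left h, max_eq_left]
            positivity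
        rw [Finset.sum_congr rfl hmax, ← Finset.sum_mul, Finset.sum_erase_eq_sub hσ, hsum]
        have := (hw σ hσ).ne'
        field_simp

theorem lmarginal_univ_minIndicator_le [Fintype U] (hσ : σ ∈ A) (hw : ∀ u ∈ A, 0 < w u)
    (hsum : ∑ u ∈ A, w u = 1) (y : U → ℝ) :
    (∫⋯∫⁻_Finset.univ, minIndicator A w σ ∂(fun _ => expMeasure 1)) y ≤ ENNReal.ofReal (w σ) := by
  have hwσ := hw σ hσ
  have hle : w σ ≤ 1 := hsum ▸ Finset.single_le_sum (fun u hu => (hw u hu).le) hσ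
  have hs : 0 ≤ 1 / w σ - 1 := by
    have := one_le_one_div hwσ hle; linarith
  rw [lmarginal_erase _ measurable_minIndicator (Finset.mem_univ σ)]
  calc _ ≤ ∫⁻ t, expDecay (1 / w σ - 1) t ∂(expMeasure 1) := by
        refine lintegral_mono fun t => ?_
        simpa using lmarginal_minIndicator_le hσ hw hsum (Function.update y σ t)
    _ = _ := by
        rw [lintegral_expDecay hs]
        congr 1
        field_simp
        ring

end Marginals

/-! ### The choice of a minimizer -/

section Selection

theorem argmin_eq_some {α : Type*} {s : Finset α} {g : α → ℝ} {a : α} (h : argmin s g = some a) :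
    a ∈ s ∧ ∀ b ∈ s, g a ≤ g b := by
  classical
  unfold argmin at h
  split_ifs at h with hne
  have := hne.choose_spec
  rw [Option.some.inj h, Finset.mem_filter] at this
  exact this

theorem exists_argmin_eq_some {α : Type*} {s : Finset α} (hs : s.Nonempty) (g : α → ℝ) :
    ∃ a, argmin s g = some a := by
  classical
  obtain ⟨a, ha, hmin⟩ := s.exists_min_image g hs
  unfold argmin
  rw [dif_pos ⟨a, Finset.mem_filter.2 ⟨ha, hmin⟩⟩]
  exact ⟨_, rfl⟩

open Classical in
theorem argmin_congr {α : Type*} {s : Finset α} {g g' : α → ℝ}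
    (h : (s.filter fun a => ∀ b ∈ s, g a ≤ g b) = s.filter fun a => ∀ b ∈ s, g' a ≤ g' b) :
    argmin s g = argmin s g' := by
  have key : ∀ t t' : Finset α, t = t' →
      (if h : t.Nonempty then some h.choose else none)
        = if h : t'.Nonempty then some h.choose else none := by
    rintro t _ rfl; rfl
  exact key _ _ h

/-- The arbitrary tie-breaking depends only on the set of minimizers, which takes finitely many
values, each on a measurable event. -/
theorem measurableSet_argmin_eq {α Ω : Type*} [MeasurableSpace Ω] {s : Finset α} {g : Ω → α → ℝ}
    (hg : ∀ a, Measurable fun ω => g ω a) (a : α) :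
    MeasurableSet {ω | argmin s (g ω) = some a} := by
  classical
  set T : Ω → Finset α := fun ω => s.filter fun a => ∀ b ∈ s, g ω a ≤ g ω b with hT
  have hmem : ∀ a ∈ s, MeasurableSet {ω | ∀ b ∈ s, g ω a ≤ g ω b} := by
    intro a _
    have : {ω | ∀ b ∈ s, g ω a ≤ g ω b} = ⋂ b ∈ s, {ω | g ω a ≤ g ω b} := by ext; simp
    rw [this]
    exact Finset.measurableSet_biInter _ fun b _ => measurableSet_le (hg a) (hg b)
  have hTm : ∀ t : Finset α, MeasurableSet {ω | T ω = t} := by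
    intro t
    by_cases ht : t ⊆ s
    · have : {ω | T ω = t} = ⋂ a ∈ s,
          (if a ∈ t then {ω | ∀ b ∈ s, g ω a ≤ g ω b} else {ω | ∀ b ∈ s, g ω a ≤ g ω b}ᶜ) := by
        ext ω
        simp only [Set.mem_iInter]
        constructor
        · intro h a ha
          have h : T ω = t := h
          rw [← h]
          split_ifs with hat
          · exact (Finset.mem_filter.1 hat).2
          · exact fun hc => hat (Finset.mem_filter.2 ⟨ha, hc⟩)
        · intro h
          refine Finset.ext fun a => ⟨fun hat => ?_, fun hat => ?_⟩
          · obtain ⟨has, hmin⟩ := Finset.mem_filter.1 hat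
            have := h a has
            by_contra hn
            rw [if_neg hn] at this
            exact this hmin
          · have := h a (ht hat)
            rw [if_pos hat] at this
            exact Finset.mem_filter.2 ⟨ht hat, this⟩
      rw [this]
      refine Finset.measurableSet_biInter _ fun a ha => ?_
      split_ifs
      exacts [hmem a ha, (hmem a ha).compl]
    · have : {ω | T ω = t} = ∅ := by
        refine Set.eq_empty_iff_forall_notMem.2 fun ω hω => ht ?_
        have hω : T ω = t := hω
        rw [← hω]; exact Finset.filter_subset _ _
      rw [this]; exact .empty
  have : {ω | argmin s (g ω) = some a} = ⋃ t ∈ s.powerset.filter (fun t =>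
      ∃ ω, T ω = t ∧ argmin s (g ω) = some a), {ω | T ω = t} := by
    ext ω
    simp only [Set.mem_iUnion, Finset.mem_filter, Finset.mem_powerset]
    constructor
    · intro h
      exact ⟨T ω, ⟨Finset.filter_subset _ _, ω, rfl, h⟩, rfl⟩
    · rintro ⟨t, ⟨_, ω', hω', h⟩, hω⟩
      have hω : T ω = t := hω
      change argmin s (g ω) = some a
      rw [argmin_congr (g' := g ω')]
      · exact h
      · exact hω.trans hω'.symm
  rw [this]
  exact Finset.measurableSet_biUnion _ fun t _ => hTm t

variable {U V : Type*} [DecidableEq U] [DecidableEq V]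
variable (E : Finset (U × V)) (x : U × V → ℝ)

theorem measurable_selection : Measurable (selection E x) := by
  classical
  refine measurable_pi_lambda _ fun e => ?_
  refine Measurable.ite (measurableSet_argmin_eq
    (g := fun (Z : U → V → ℝ) f => Z f.1 f.2 / x f) (fun f => ?_) e) measurable_const
    measurable_const
  exact ((measurable_pi_apply f.2).comp (measurable_pi_apply f.1)).div_const _

variable {E x}

theorem selection_eq_zero_or_one (Z : U → V → ℝ) (e : U × V) :
    selection E x Z e = 0 ∨ selection E x Z e = 1 := by
  unfold selection; split_ifs <;> simp

theorem selection_nonneg (Z : U → V → ℝ) (e : U × V) : 0 ≤ selection E x Z e := by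
  rcases selection_eq_zero_or_one (E := E) (x := x) Z e with h | h <;> simp [h]

theorem selection_of_notMem (Z : U → V → ℝ) {e : U × V} (he : e ∉ E) :
    selection E x Z e = 0 := by
  unfold selection
  rw [if_neg]
  intro h
  exact he (Finset.mem_filter.1 (argmin_eq_some h).1).1

theorem selection_mul_eq_zero (Z : U → V → ℝ) {e e' : U × V} (hne : e ≠ e') (h2 : e.2 = e'.2) :
    selection E x Z e * selection E x Z e' = 0 := by
  unfold selection
  rw [h2]
  by_cases h : argmin (rightEdges E e'.2) (fun f => Z f.1 f.2 / x f) = some e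
  · by_cases h' : argmin (rightEdges E e'.2) (fun f => Z f.1 f.2 / x f) = some e'
    · exact absurd (Option.some.inj (h.symm.trans h')) hne
    · rw [if_neg h', mul_zero]
  · rw [if_neg h, zero_mul]

theorem sum_selection_eq_one (Z : U → V → ℝ) {v : V} (hv : (rightEdges E v).Nonempty) :
    ∑ e ∈ rightEdges E v, selection E x Z e = 1 := by
  obtain ⟨a, ha⟩ := exists_argmin_eq_some hv (fun f => Z f.1 f.2 / x f)
  have hav := (argmin_eq_some ha).1
  have h2 : ∀ e ∈ rightEdges E v, e.2 = v := fun e he => (Finset.mem_filter.1 he).2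
  rw [Finset.sum_eq_single_of_mem a hav]
  · unfold selection
    rw [h2 a hav, if_pos ha]
  · intro b hb hba
    unfold selection
    rw [h2 b hb, if_neg]
    exact fun h => hba (Option.some.inj (h.symm.trans ha))

end Selection

/-! ### Correlation bounds for normalized instances -/

section Normalized

variable {U V : Type*} [DecidableEq U] [DecidableEq V]

/-- The rates handed to `CorrelatedExponential` at the left-node `u`. -/
def rowRates (E : Finset (U × V)) (ρ : U × V → ℝ) (u : U) (v : V) : ℝ :=
  if (u, v) ∈ E then ρ (u, v) else 0

/-- A fractional instance in which every right-node with an edge has total mass one. -/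
structure IsNormalized (E : Finset (U × V)) (x ρ : U × V → ℝ) : Prop where
  pos : ∀ e ∈ E, 0 < x e
  sum_eq_one : ∀ v, (rightEdges E v).Nonempty → ∑ e ∈ rightEdges E v, x e = 1
  rate_nonneg : ∀ e ∈ E, 0 ≤ ρ e
  rate_sum_le : ∀ u, ∑ e ∈ leftEdges E u, ρ e ≤ 1

variable {E : Finset (U × V)} {x ρ : U × V → ℝ}

namespace IsNormalized

variable (hN : IsNormalized E x ρ)
include hN

theorem rowRates_nonneg (u : U) (v : V) : 0 ≤ rowRates E ρ u v := by
  unfold rowRates; split_ifs with h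
  exacts [hN.rate_nonneg _ h, le_rfl]

end IsNormalized

section

variable [Fintype V]

theorem sum_rowRates (u : U) : ∑ v, rowRates E ρ u v = ∑ e ∈ leftEdges E u, ρ e := by
  unfold rowRates
  rw [← Finset.sum_filter]
  refine Finset.sum_bij (fun v _ => (u, v)) ?_ ?_ ?_ ?_
  · intro v hv
    exact Finset.mem_filter.2 ⟨(Finset.mem_filter.1 hv).2, rfl⟩
  · intro a _ b _ h
    exact congrArg Prod.snd h
  · rintro ⟨a, b⟩ he
    obtain ⟨hmem, rfl : a = u⟩ := Finset.mem_filter.1 he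
    exact ⟨b, Finset.mem_filter.2 ⟨Finset.mem_univ _, hmem⟩, rfl⟩
  · intro u _; rfl

namespace IsNormalized

variable (hN : IsNormalized E x ρ)
include hN

theorem sum_rowRates_le (u : U) : ∑ v, rowRates E ρ u v ≤ 1 :=
  (sum_rowRates u).trans_le (hN.rate_sum_le u)

theorem isProbabilityMeasure_row (u : U) :
    IsProbabilityMeasure (correlatedExponential (rowRates E ρ u)) :=
  isProbabilityMeasure_correlatedExponential (hN.rowRates_nonneg u) (hN.sum_rowRates_le u)

end IsNormalized

end

variable [Fintype U]

/-- The left-nodes adjacent to `v`. -/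
def leftNeighbors (E : Finset (U × V)) (v : V) : Finset U :=
  Finset.univ.filter fun u => (u, v) ∈ E

theorem mem_leftNeighbors {u : U} {v : V} :
    u ∈ leftNeighbors E v ↔ (u, v) ∈ E := by
  simp [leftNeighbors]

theorem sum_rightEdges (v : V) (f : U × V → ℝ) :
    ∑ e ∈ rightEdges E v, f e = ∑ u ∈ leftNeighbors E v, f (u, v) := by
  refine (Finset.sum_bij (fun u _ => (u, v)) ?_ ?_ ?_ ?_).symm
  · intro u hu
    exact Finset.mem_filter.2 ⟨(Finset.mem_filter.1 hu).2, rfl⟩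
  · intro a _ b _ h
    exact congrArg Prod.fst h
  · rintro ⟨a, b⟩ he
    obtain ⟨hmem, rfl : b = v⟩ := Finset.mem_filter.1 he
    exact ⟨a, mem_leftNeighbors.2 hmem, rfl⟩
  · intro u _; rfl

namespace IsNormalized

variable (hN : IsNormalized E x ρ)
include hN

theorem sum_leftNeighbors {u : U} {v : V} (h : (u, v) ∈ E) :
    ∑ u ∈ leftNeighbors E v, x (u, v) = 1 := by
  rw [← sum_rightEdges]
  exact hN.sum_eq_one v ⟨(u, v), Finset.mem_filter.2 ⟨h, rfl⟩⟩

theorem pos_of_mem_leftNeighbors {v : V} : ∀ u ∈ leftNeighbors E v, 0 < x (u, v) :=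
  fun _ hu => hN.pos _ (Finset.mem_filter.1 hu).2

end IsNormalized

/-- The right side counts every tied minimizer as a winner. An upper bound suffices, so the
probability of ties is never needed. -/
theorem ofReal_selection_le (Z : U → V → ℝ) (u : U) (v : V) :
    ENNReal.ofReal (selection E x Z (u, v))
      ≤ minIndicator (leftNeighbors E v) (fun u => x (u, v)) u (fun u => Z u v) := by
  unfold selection
  split_ifs with h
  · have := (argmin_eq_some h).2
    unfold minIndicator
    rw [if_pos]
    · simp
    · intro a ha
      exact this (a, v) (Finset.mem_filter.2 ⟨(Finset.mem_filter.1 ha).2, rfl⟩)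
  · simp

/-- The factor at the right-node `v`: the event that `σ v` wins there, if `v` belongs to `R`. -/
noncomputable def winFactor (E : Finset (U × V)) (x : U × V → ℝ) (R : Finset V) (σ : V → U) (v : V)
    (y : U → ℝ) : ℝ≥0∞ :=
  if v ∈ R then minIndicator (leftNeighbors E v) (fun u => x (u, v)) (σ v) y else 1

theorem measurable_winFactor (R : Finset V) (σ : V → U) (v : V) :
    Measurable (winFactor E x R σ v) := by
  unfold winFactor; split_ifs
  exacts [measurable_minIndicator, measurable_const]

theorem winFactor_le_one (R : Finset V) (σ : V → U) (v : V) (y : U → ℝ) :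
    winFactor E x R σ v y ≤ 1 := by
  unfold winFactor; split_ifs
  exacts [minIndicator_le_one y, le_rfl]

/-- If `u` is chosen at some right-node of `R`, stability makes it absent wherever another left-node
is chosen, so it acts only as a winner and all factors decrease. If it is never chosen, it acts only
as a rival and all factors increase. -/
theorem IsNormalized.winFactor_monotone (hN : IsNormalized E x ρ) {R : Finset V} {σ : V → U}
    (hσ : ∀ v ∈ R, (σ v, v) ∈ E)
    (hstable : ∀ v ∈ R, ∀ v' ∈ R, σ v ≠ σ v' → (σ v, v') ∉ E) (u : U) :
    (∀ v y, Monotone fun t => winFactor E x R σ v (Function.update y u t)) ∨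
      ∀ v y, Antitone fun t => winFactor E x R σ v (Function.update y u t) := by
  by_cases hu : ∃ v₀ ∈ R, σ v₀ = u
  · obtain ⟨v₀, hv₀, rfl⟩ := hu
    right
    intro v y
    by_cases hv : v ∈ R
    · simp only [winFactor, if_pos hv]
      by_cases he : σ v₀ = σ v
      · rw [he]
        exact antitone_minIndicator_update (w := fun u => x (u, v)) (hN.pos _ (hσ v hv)).le y
      · have hn : σ v₀ ∉ leftNeighbors E v := fun h =>
          hstable v₀ hv₀ v hv he (Finset.mem_filter.1 h).2
        simp only [minIndicator_update_of_notMem he hn]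
        exact antitone_const
    · simp only [winFactor, if_neg hv]
      exact antitone_const
  · left
    intro v y
    by_cases hv : v ∈ R
    · simp only [winFactor, if_pos hv]
      have he : u ≠ σ v := fun h => hu ⟨v, hv, h.symm⟩
      by_cases hn : u ∈ leftNeighbors E v
      · exact monotone_minIndicator_update he (hN.pos_of_mem_leftNeighbors u hn).le y
      · simp only [minIndicator_update_of_notMem he hn]
        exact monotone_const
    · simp only [winFactor, if_neg hv]
      exact monotone_const

variable [Fintype V]

theorem prod_selection_le (R : Finset V) (σ : V → U) (Z : U → V → ℝ) :
    ∏ v ∈ R, ENNReal.ofReal (selection E x Z (σ v, v))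
      ≤ ∏ v, winFactor E x R σ v (fun u => Z u v) := by
  rw [← Finset.prod_subset (Finset.subset_univ R)
    (f := fun v => winFactor E x R σ v (fun u => Z u v))
    (fun v _ hv => by simp [winFactor, hv])]
  refine Finset.prod_le_prod' fun v hv => ?_
  rw [winFactor, if_pos hv]
  exact ofReal_selection_le Z _ v

theorem measurable_prod_winFactor (R : Finset V) (σ : V → U) :
    Measurable fun Z : U → V → ℝ => ∏ v, winFactor E x R σ v (fun u => Z u v) := by
  refine Finset.measurable_fun_prod _ fun v _ => (measurable_winFactor R σ v).comp ?_
  exact measurable_pi_lambda _ fun u => (measurable_pi_apply v).comp (measurable_pi_apply u)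

/-- Nonpositive correlation along a stable selection `σ` of left-nodes. -/
theorem IsNormalized.lintegral_prod_selection_le (hN : IsNormalized E x ρ) {R : Finset V}
    {σ : V → U} (hσ : ∀ v ∈ R, (σ v, v) ∈ E)
    (hstable : ∀ v ∈ R, ∀ v' ∈ R, σ v ≠ σ v' → (σ v, v') ∉ E) :
    ∫⁻ Z, ∏ v ∈ R, ENNReal.ofReal (selection E x Z (σ v, v))
        ∂(Measure.pi fun u => correlatedExponential (rowRates E ρ u))
      ≤ ∏ v ∈ R, ENNReal.ofReal (x (σ v, v)) := by
  have := hN.isProbabilityMeasure_row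
  calc _ ≤ ∫⁻ Z, ∏ v, winFactor E x R σ v (fun u => Z u v)
        ∂(Measure.pi fun u => correlatedExponential (rowRates E ρ u)) :=
        lintegral_mono fun Z => prod_selection_le R σ Z
    _ = (∫⋯∫⁻_Finset.univ, (fun Z => ∏ v, winFactor E x R σ v (fun u => Z u v))
          ∂(fun u => correlatedExponential (rowRates E ρ u))) (fun _ _ => 0) :=
        lintegral_eq_lmarginal_univ _
    _ ≤ ∏ v, (∫⋯∫⁻_Finset.univ, winFactor E x R σ v ∂(fun _ => expMeasure 1)) (fun _ => 0) :=
        lmarginal_prod_le _ (fun u _ hle hmono => lintegral_correlatedExponential_prod_le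
          (hN.rowRates_nonneg u) (hN.sum_rowRates_le u) hle hmono) _
          (measurable_winFactor R σ) (winFactor_le_one R σ) _
          (fun u _ => hN.winFactor_monotone hσ hstable u) _
    _ ≤ ∏ v, (if v ∈ R then ENNReal.ofReal (x (σ v, v)) else 1) := by
        refine Finset.prod_le_prod' fun v _ => ?_
        split_ifs with hv
        · have hw : winFactor E x R σ v
              = minIndicator (leftNeighbors E v) (fun u => x (u, v)) (σ v) := by
            funext y; simp [winFactor, hv]
          rw [hw]
          exact lmarginal_univ_minIndicator_le
            (mem_leftNeighbors.2 (hσ v hv)) hN.pos_of_mem_leftNeighbors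
            (hN.sum_leftNeighbors (hσ v hv)) _
        · exact (lintegral_mono fun _ => winFactor_le_one R σ v _).trans (by simp)
    _ = _ := by simp [Finset.prod_ite_mem]

/-- Strong negative correlation of two edges at a common left-node. -/
theorem IsNormalized.lintegral_selection_pair_le (hN : IsNormalized E x ρ) {u : U} {v₁ v₂ : V}
    (hne : v₁ ≠ v₂) (h₁ : (u, v₁) ∈ E) (h₂ : (u, v₂) ∈ E)
    (hx₁ : x (u, v₁) ∈ Set.Ioo (0 : ℝ) 1) (hx₂ : x (u, v₂) ∈ Set.Ioo (0 : ℝ) 1)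
    (hρ₁ : ρ (u, v₁) ∈ Set.Ioo (0 : ℝ) 1) (hρ₂ : ρ (u, v₂) ∈ Set.Ioo (0 : ℝ) 1) :
    ∫⁻ Z, ENNReal.ofReal (selection E x Z (u, v₁)) * ENNReal.ofReal (selection E x Z (u, v₂))
        ∂(Measure.pi fun u => correlatedExponential (rowRates E ρ u))
      ≤ ENNReal.ofReal (x (u, v₁) * x (u, v₂)
          * (1 - Phi (x (u, v₁)) (x (u, v₂)) (ρ (u, v₁)) (ρ (u, v₂)))) := by
  have := hN.isProbabilityMeasure_row
  set R : Finset V := {v₁, v₂} with hR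
  set σ : V → U := fun _ => u with hσdef
  have hmemR : ∀ v, v ∈ R ↔ v = v₁ ∨ v = v₂ := fun v => by simp [hR]
  have hσ : ∀ v ∈ R, (σ v, v) ∈ E := by
    intro v hv
    rcases (hmemR v).1 hv with rfl | rfl
    exacts [h₁, h₂]
  have hrow₁ : rowRates E ρ u v₁ = ρ (u, v₁) := if_pos h₁
  have hrow₂ : rowRates E ρ u v₂ = ρ (u, v₂) := if_pos h₂
  rw [← hrow₁] at hρ₁ ⊢
  rw [← hrow₂] at hρ₂ ⊢
  calc _ ≤ ∫⁻ Z, ∏ v, winFactor E x R σ v (fun u => Z u v)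
        ∂(Measure.pi fun u => correlatedExponential (rowRates E ρ u)) := by
        refine lintegral_mono fun Z => le_trans (le_of_eq ?_) (prod_selection_le R σ Z)
        rw [hR, Finset.prod_pair hne]
    -- Row `u` keeps its correlated law and is integrated last; only the other rows are decoupled.
    _ = ∫⁻ w, (∫⋯∫⁻_(Finset.erase Finset.univ u),
          (fun Z => ∏ v, winFactor E x R σ v (fun u => Z u v))
          ∂(fun u => correlatedExponential (rowRates E ρ u)))
          (Function.update (fun _ _ => 0) u w) ∂(correlatedExponential (rowRates E ρ u)) := by
        rw [lintegral_eq_lmarginal_univ (fun _ _ => (0 : ℝ)),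
          lmarginal_erase _ (measurable_prod_winFactor R σ) (Finset.mem_univ u)]
    _ ≤ ∫⁻ w, expDecay (1 / x (u, v₁) - 1) (w v₁) * expDecay (1 / x (u, v₂) - 1) (w v₂)
          ∂(correlatedExponential (rowRates E ρ u)) := by
        refine lintegral_mono fun w => ?_
        refine (lmarginal_prod_le (fun u => correlatedExponential (rowRates E ρ u))
          (fun u _ hle hmono => lintegral_correlatedExponential_prod_le
          (hN.rowRates_nonneg u) (hN.sum_rowRates_le u) hle hmono) _
          (measurable_winFactor R σ) (winFactor_le_one R σ) _
          -- Since `σ` is constant, the stability requirement is vacuous.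
          (fun u _ => hN.winFactor_monotone hσ (fun _ _ _ _ h => absurd rfl h) u) _).trans ?_
        rw [← Finset.prod_subset (Finset.subset_univ R) (fun v _ hv => ?_)]
        · rw [hR, Finset.prod_pair hne]
          have hfac : ∀ v ∈ R, (∫⋯∫⁻_(Finset.erase Finset.univ u), winFactor E x R σ v
              ∂(fun _ => expMeasure 1))
              (fun u' => Function.update (fun _ _ => (0 : ℝ)) u w u' v)
              ≤ expDecay (1 / x (u, v) - 1) (w v) := by
            intro v hv
            have hw : winFactor E x R σ v
                = minIndicator (leftNeighbors E v) (fun u => x (u, v)) u := by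
              funext y; simp [winFactor, hv, hσdef]
            rw [hw]
            refine (lmarginal_minIndicator_le
              (mem_leftNeighbors.2 (hσ v hv)) hN.pos_of_mem_leftNeighbors
              (hN.sum_leftNeighbors (hσ v hv)) _).trans (le_of_eq ?_)
            simp [hσdef]
          exact mul_le_mul' (hfac v₁ (by simp [hR])) (hfac v₂ (by simp [hR]))
        · have hw : winFactor E x R σ v = fun _ => 1 := by
            funext y; simp [winFactor, hv]
          rw [hw, lmarginal]
          simp
    _ ≤ _ := lintegral_correlatedExponential_pair_le (hN.rowRates_nonneg u) (hN.sum_rowRates_le u)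
        hne hρ₁ hρ₂ hx₁ hx₂

end Normalized

/-! ### Exact marginals for normalized instances -/

section Normalized

variable {U V : Type*} [Fintype U] [DecidableEq U] [Fintype V] [DecidableEq V]
variable {E : Finset (U × V)} {x ρ : U × V → ℝ}

/-- The joint law of the exponential variables of all left-nodes. -/
noncomputable def rowLaw (E : Finset (U × V)) (ρ : U × V → ℝ) : Measure (U → V → ℝ) :=
  Measure.pi fun u => correlatedExponential (rowRates E ρ u)

namespace IsNormalized

variable (hN : IsNormalized E x ρ)
include hN

theorem isProbabilityMeasure_rowLaw : IsProbabilityMeasure (rowLaw E ρ) := by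
  have := hN.isProbabilityMeasure_row
  unfold rowLaw
  infer_instance

/-- Every edge is selected with its prescribed probability. -/
theorem integral_selection {e : U × V} (he : e ∈ E) :
    ∫ Z, selection E x Z e ∂(rowLaw E ρ) = x e := by
  have := hN.isProbabilityMeasure_rowLaw
  have hm : ∀ f, Measurable fun Z => selection E x Z f := fun f =>
    (measurable_pi_apply f).comp (measurable_selection E x)
  have hint : ∀ f, Integrable (fun Z => selection E x Z f) (rowLaw E ρ) := fun f =>
    Integrable.of_bound (hm f).aestronglyMeasurable 1 (ae_of_all _ fun Z => by
      rcases selection_eq_zero_or_one (E := E) (x := x) Z f with h | h <;> simp [h])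
  have hle : ∀ f ∈ rightEdges E e.2, ∫ Z, selection E x Z f ∂(rowLaw E ρ) ≤ x f := by
    intro f hf
    have hfE := (Finset.mem_filter.1 hf).1
    have key := hN.lintegral_prod_selection_le (R := {f.2}) (σ := fun _ => f.1)
      (fun v hv => by rw [Finset.mem_singleton.1 hv]; exact hfE)
      (fun _ _ _ _ h => absurd rfl h)
    simp only [Finset.prod_singleton] at key
    rw [integral_eq_lintegral_of_nonneg_ae (ae_of_all _ fun Z => selection_nonneg Z f)
      (hm f).aestronglyMeasurable]
    exact ENNReal.toReal_le_of_le_ofReal (hN.pos f hfE).le key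
  have hmem : e ∈ rightEdges E e.2 := Finset.mem_filter.2 ⟨he, rfl⟩
  -- Exactly one edge is selected at the right-node, so both sums are one; the termwise bounds `hle`
  -- must then all be equalities.
  have hsum : ∑ f ∈ rightEdges E e.2, ∫ Z, selection E x Z f ∂(rowLaw E ρ)
      = ∑ f ∈ rightEdges E e.2, x f := by
    rw [← integral_finsetSum _ fun f _ => hint f, hN.sum_eq_one _ ⟨e, hmem⟩]
    simp only [sum_selection_eq_one _ (⟨e, hmem⟩ : (rightEdges E e.2).Nonempty)]
    simp
  exact (Finset.sum_eq_sum_iff_of_le hle).1 hsum e hmem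

end IsNormalized

end Normalized

/-! ### Reduction of a general instance to a normalized one -/

section Reduction

variable {U V : Type*} [DecidableEq U] [DecidableEq V]
variable {E : Finset (U × V)} {x ρ : U × V → ℝ}

theorem measurable_restoreOutput (E : Finset (U × V)) (x : U × V → ℝ) :
    Measurable (restoreOutput E x) := by
  refine measurable_pi_lambda _ fun e => ?_
  unfold restoreOutput
  split_ifs
  · exact measurable_const
  · exact measurable_pi_apply _

/-- An instance of the rounding problem. -/
structure IsInstance (E : Finset (U × V)) (x ρ : U × V → ℝ) : Prop where
  mem_Icc : ∀ e ∈ E, x e ∈ Set.Icc (0 : ℝ) 1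
  rate_mem_Icc : ∀ e ∈ E, ρ e ∈ Set.Icc (0 : ℝ) 1
  sum_le : ∀ v : V, ∑ e ∈ rightEdges E v, x e ≤ 1
  rate_sum_le : ∀ u : U, ∑ e ∈ leftEdges E u, ρ e ≤ 1

namespace IsInstance

variable (hI : IsInstance E x ρ)
include hI

theorem eq_zero_of_eq_one {e e' : U × V} (he : e ∈ E) (he' : e' ∈ E) (hne : e ≠ e')
    (h2 : e.2 = e'.2) (h1 : x e = 1) : x e' = 0 := by
  have hsub : ({e, e'} : Finset (U × V)) ⊆ rightEdges E e.2 := by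
    intro f hf
    rcases Finset.mem_insert.1 hf with rfl | hf
    · exact Finset.mem_filter.2 ⟨he, rfl⟩
    · rw [Finset.mem_singleton.1 hf]
      exact Finset.mem_filter.2 ⟨he', h2.symm⟩
  have := (Finset.sum_le_sum_of_subset_of_nonneg hsub
    (fun f hf _ => (hI.mem_Icc f (Finset.mem_filter.1 hf).1).1)).trans (hI.sum_le e.2)
  rw [Finset.sum_pair hne, h1] at this
  linarith [(hI.mem_Icc e' he').1]

theorem slack_nonneg (v : V) : 0 ≤ slack E x v := sub_nonneg.2 (hI.sum_le v)

theorem le_one_sub_slack {u : U} {v : V} (h : (u, v) ∈ E) : x (u, v) ≤ 1 - slack E x v := by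
  have := Finset.single_le_sum (f := x) (s := rightEdges E v)
    (fun f hf => (hI.mem_Icc f (Finset.mem_filter.1 hf).1).1)
    (Finset.mem_filter.2 ⟨h, rfl⟩ : (u, v) ∈ rightEdges E v)
  rw [slack]; linarith

end IsInstance

variable [Fintype V]

theorem mem_normEdges_inl {u : U} {v : V} :
    (Sum.inl u, v) ∈ normEdges E x ↔ (u, v) ∈ E ∧ 0 < x (u, v) ∧ x (u, v) < 1 := by
  simp [normEdges]

theorem mem_normEdges_inr {w v : V} :
    (Sum.inr w, v) ∈ normEdges E x ↔ w = v ∧ 0 < slack E x v ∧ slack E x v < 1 := by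
  simp only [normEdges, Finset.mem_union, Finset.mem_image, Finset.mem_filter, Finset.mem_univ,
    true_and, Prod.mk.injEq, reduceCtorEq, false_and, and_false, exists_false, false_or,
    Sum.inr.injEq]
  constructor
  · rintro ⟨a, h, rfl, rfl⟩; exact ⟨rfl, h⟩
  · rintro ⟨rfl, h⟩; exact ⟨w, h, rfl, rfl⟩

namespace IsInstance

variable (hI : IsInstance E x ρ)
include hI

/-- A right-node that keeps an edge, original or dummy, has no edge of value `1`. All edges removed
there have value `0`, and the dummy edge completes the mass to one. -/
theorem isNormalized [Fintype U] :
    IsNormalized (normEdges E x) (normX E x) (normRho ρ) where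
  pos := by
    rintro ⟨u | w, v⟩ he
    · exact (mem_normEdges_inl.1 he).2.1
    · exact (mem_normEdges_inr.1 he).2.1
  sum_eq_one := by
    rintro v ⟨⟨a, b⟩, hab⟩
    obtain ⟨he, rfl : b = v⟩ := Finset.mem_filter.1 hab
    have hlt : slack E x b < 1 ∧ ∀ u, (u, b) ∈ E → x (u, b) < 1 := by
      rcases a with u | w
      · obtain ⟨hu, h0, h1⟩ := mem_normEdges_inl.1 he
        refine ⟨by linarith [hI.le_one_sub_slack hu], fun u' hu' => ?_⟩
        refine lt_of_le_of_ne (hI.mem_Icc _ hu').2 fun heq => ?_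
        by_cases hne : (u', b) = (u, b)
        · rw [hne] at heq; linarith
        · linarith [hI.eq_zero_of_eq_one hu' hu hne rfl heq]
      · obtain ⟨rfl, h0, h1⟩ := mem_normEdges_inr.1 he
        exact ⟨h1, fun u' hu' => by linarith [hI.le_one_sub_slack hu']⟩
    rw [sum_rightEdges, leftNeighbors, Finset.sum_filter, Fintype.sum_sum_type]
    have hl : ∀ u : U, (if (Sum.inl u, b) ∈ normEdges E x then normX E x (Sum.inl u, b) else 0)
        = if (u, b) ∈ E then x (u, b) else 0 := by
      intro u
      by_cases hu : (u, b) ∈ E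
      · rw [if_pos hu]
        by_cases h0 : 0 < x (u, b)
        · rw [if_pos (mem_normEdges_inl.2 ⟨hu, h0, hlt.2 u hu⟩)]; rfl
        · rw [if_neg fun h => h0 (mem_normEdges_inl.1 h).2.1]
          exact le_antisymm (hI.mem_Icc _ hu).1 (not_lt.1 h0)
      · rw [if_neg hu, if_neg fun h => hu (mem_normEdges_inl.1 h).1]
    have hr : ∀ w : V, (if (Sum.inr w, b) ∈ normEdges E x then normX E x (Sum.inr w, b) else 0)
        = if w = b then slack E x b else 0 := by
      intro w
      by_cases hw : w = b
      · rw [if_pos hw]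
        by_cases h0 : 0 < slack E x b
        · rw [if_pos (mem_normEdges_inr.2 ⟨hw, h0, hlt.1⟩)]; rfl
        · rw [if_neg fun h => h0 (mem_normEdges_inr.1 h).2.1]
          exact le_antisymm (hI.slack_nonneg b) (not_lt.1 h0)
      · rw [if_neg hw, if_neg fun h => hw (mem_normEdges_inr.1 h).1]
    simp only [hl, hr, Finset.sum_ite_eq', Finset.mem_univ, if_true]
    rw [slack, sum_rightEdges, leftNeighbors, Finset.sum_filter]
    ring
  rate_nonneg := by
    rintro ⟨u | w, v⟩ he
    · exact (hI.rate_mem_Icc _ (mem_normEdges_inl.1 he).1).1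
    · exact le_rfl
  rate_sum_le := by
    rintro (u | w)
    · refine le_trans ?_ (hI.rate_sum_le u)
      rw [← sum_rowRates, ← sum_rowRates]
      refine Finset.sum_le_sum fun v _ => ?_
      unfold rowRates
      by_cases hu : (u, v) ∈ E
      · rw [if_pos hu]
        split_ifs
        · exact le_rfl
        · exact (hI.rate_mem_Icc _ hu).1
      · rw [if_neg hu, if_neg fun h => hu (mem_normEdges_inl.1 h).1]
    · rw [← sum_rowRates]
      unfold rowRates
      simp [normRho]

end IsInstance

/-- The output vector as a function of the exponential variables of the normalized instance. -/
noncomputable def roundedVector (E : Finset (U × V)) (x : U × V → ℝ) (Z : U ⊕ V → V → ℝ) :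
    U × V → ℝ :=
  restoreOutput E x (selection (normEdges E x) (normX E x) Z)

theorem measurable_roundedVector (E : Finset (U × V)) (x : U × V → ℝ) :
    Measurable (roundedVector E x) :=
  (measurable_restoreOutput E x).comp (measurable_selection _ _)

theorem depRound_eq_map [Fintype U] :
    depRound E x ρ = (rowLaw (normEdges E x) (normRho ρ)).map (roundedVector E x) :=
  Measure.map_map (measurable_restoreOutput E x) (measurable_selection _ _)

variable (Z : U ⊕ V → V → ℝ) {e e' : U × V}

theorem roundedVector_of_eq_one (he : e ∈ E) (h : x e = 1) : roundedVector E x Z e = 1 :=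
  if_pos ⟨he, h⟩

theorem roundedVector_of_ne_one (h : x e ≠ 1) :
    roundedVector E x Z e
      = selection (normEdges E x) (normX E x) Z (Sum.inl e.1, e.2) :=
  if_neg fun hc => h hc.2

theorem roundedVector_of_eq_zero (h : x e = 0) : roundedVector E x Z e = 0 := by
  rw [roundedVector_of_ne_one Z (by rw [h]; norm_num)]
  exact selection_of_notMem Z fun hc => (mem_normEdges_inl.1 hc).2.1.ne' h

theorem roundedVector_eq_zero_or_one : roundedVector E x Z e = 0 ∨ roundedVector E x Z e = 1 := by
  unfold roundedVector restoreOutput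
  split_ifs
  · exact .inr rfl
  · exact selection_eq_zero_or_one Z _

theorem roundedVector_nonneg : 0 ≤ roundedVector E x Z e := by
  rcases roundedVector_eq_zero_or_one (E := E) (x := x) (e := e) Z with h | h <;> simp [h]

theorem IsInstance.roundedVector_mul_eq_zero (hI : IsInstance E x ρ) (he : e ∈ E) (he' : e' ∈ E)
    (hne : e ≠ e') (h2 : e.2 = e'.2) : roundedVector E x Z e * roundedVector E x Z e' = 0 := by
  by_cases h1 : x e = 1
  · rw [roundedVector_of_eq_zero Z (hI.eq_zero_of_eq_one he he' hne h2 h1), mul_zero]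
  by_cases h1' : x e' = 1
  · rw [roundedVector_of_eq_zero Z (hI.eq_zero_of_eq_one he' he hne.symm h2.symm h1'), zero_mul]
  rw [roundedVector_of_ne_one Z h1, roundedVector_of_ne_one Z h1']
  refine selection_mul_eq_zero Z (fun h => hne ?_) h2
  exact Prod.ext (Sum.inl_injective (congrArg Prod.fst h)) h2

theorem IsInstance.sum_roundedVector_le_one (hI : IsInstance E x ρ) (v : V) :
    ∑ e ∈ rightEdges E v, roundedVector E x Z e ≤ 1 := by
  by_cases h : ∃ e ∈ rightEdges E v, roundedVector E x Z e = 1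
  · obtain ⟨e, he, h1⟩ := h
    obtain ⟨heE, he2⟩ := Finset.mem_filter.1 he
    rw [Finset.sum_eq_single_of_mem e he, h1]
    intro f hf hfe
    obtain ⟨hfE, hf2⟩ := Finset.mem_filter.1 hf
    simpa [h1] using hI.roundedVector_mul_eq_zero Z hfE heE hfe (hf2.trans he2.symm)
  · rw [Finset.sum_eq_zero]
    · exact zero_le_one
    · intro e he
      exact (roundedVector_eq_zero_or_one Z).resolve_right fun h1 => h ⟨e, he, h1⟩

variable [Fintype U]

theorem integral_depRound_le {g : (U × V → ℝ) → ℝ} (hg : Measurable g) {c : ℝ} (hc : 0 ≤ c)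
    (h0 : ∀ Z, 0 ≤ g (roundedVector E x Z))
    (h : ∫⁻ Z, ENNReal.ofReal (g (roundedVector E x Z)) ∂(rowLaw (normEdges E x) (normRho ρ))
      ≤ ENNReal.ofReal c) :
    ∫ X, g X ∂(depRound E x ρ) ≤ c := by
  rw [depRound_eq_map, integral_map (measurable_roundedVector E x).aemeasurable
    hg.aestronglyMeasurable, integral_eq_lintegral_of_nonneg_ae (ae_of_all _ h0)
    (hg.comp (measurable_roundedVector E x)).aestronglyMeasurable]
  exact ENNReal.toReal_le_of_le_ofReal hc h

namespace IsInstance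

variable (hI : IsInstance E x ρ)
include hI

theorem isProbabilityMeasure_depRound : IsProbabilityMeasure (depRound E x ρ) := by
  have := hI.isNormalized.isProbabilityMeasure_rowLaw
  rw [depRound_eq_map]
  exact Measure.isProbabilityMeasure_map (measurable_roundedVector E x).aemeasurable

theorem integral_depRound_apply {e : U × V} (he : e ∈ E) :
    ∫ X, X e ∂(depRound E x ρ) = x e := by
  have := hI.isNormalized.isProbabilityMeasure_rowLaw
  rw [depRound_eq_map, integral_map (measurable_roundedVector E x).aemeasurable
    (measurable_pi_apply e).aestronglyMeasurable]
  by_cases h1 : x e = 1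
  · simp [roundedVector_of_eq_one _ he h1, h1]
  by_cases h0 : x e = 0
  · simp [roundedVector_of_eq_zero _ h0, h0]
  simp only [roundedVector_of_ne_one _ h1]
  obtain ⟨hx0, hx1⟩ := hI.mem_Icc e he
  exact hI.isNormalized.integral_selection (e := (Sum.inl e.1, e.2))
    (mem_normEdges_inl.2 ⟨he, lt_of_le_of_ne hx0 (Ne.symm h0), lt_of_le_of_ne hx1 h1⟩)

theorem integral_prod_depRound_le {L : Finset (U × V)} (hL : IsStable E L) :
    ∫ X, ∏ e ∈ L, X e ∂(depRound E x ρ) ≤ ∏ e ∈ L, x e := by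
  classical
  have hx0 : ∀ e ∈ L, 0 ≤ x e := fun e he => (hI.mem_Icc e (hL.1 he)).1
  refine integral_depRound_le (g := fun X => ∏ e ∈ L, X e)
    (Finset.measurable_fun_prod _ fun e _ => measurable_pi_apply e) (Finset.prod_nonneg hx0)
    (fun Z => Finset.prod_nonneg fun e _ => roundedVector_nonneg Z) ?_
  have hvanish : (∀ Z, ∏ e ∈ L, roundedVector E x Z e = 0) →
      ∫⁻ Z, ENNReal.ofReal (∏ e ∈ L, roundedVector E x Z e)
        ∂(rowLaw (normEdges E x) (normRho ρ)) ≤ ENNReal.ofReal (∏ e ∈ L, x e) := fun h => by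
    simp [h]
  by_cases hz : ∃ e ∈ L, x e = 0
  · obtain ⟨e, he, h0⟩ := hz
    exact hvanish fun Z => Finset.prod_eq_zero he (roundedVector_of_eq_zero Z h0)
  -- Two edges of `L` at the same right-node are never both chosen. Otherwise `L` assigns at most
  -- one left-node to each right-node, as the normalized bound requires.
  by_cases hinj : Set.InjOn Prod.snd (L : Set (U × V))
  swap
  · simp only [Set.InjOn, not_forall] at hinj
    obtain ⟨e, he, e', he', h2, hne⟩ := hinj
    refine hvanish fun Z => ?_
    rcases mul_eq_zero.1 (hI.roundedVector_mul_eq_zero Z (hL.1 he) (hL.1 he') hne h2) with h | h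
    exacts [Finset.prod_eq_zero he h, Finset.prod_eq_zero he' h]
  -- Edges of value `1` contribute the factor `1` to both products.
  set L' := L.filter fun e => x e ≠ 1 with hL'
  have hsub : L' ⊆ L := Finset.filter_subset _ _
  have hinj' : Set.InjOn Prod.snd (L' : Set (U × V)) := hinj.mono (by exact_mod_cast hsub)
  set σ : V → U ⊕ V := fun v => if h : ∃ u, (u, v) ∈ L' then Sum.inl h.choose else Sum.inr v
    with hσ
  have hσe : ∀ e ∈ L', σ e.2 = Sum.inl e.1 := by
    rintro ⟨u, v⟩ he
    have hex : ∃ u, (u, v) ∈ L' := ⟨u, he⟩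
    simp only [hσ, dif_pos hex]
    exact congrArg Sum.inl (congrArg Prod.fst (hinj' hex.choose_spec he rfl))
  have hedge : ∀ e ∈ L', (σ e.2, e.2) ∈ normEdges E x := by
    intro e he
    have heL := hsub he
    obtain ⟨h0, h1⟩ := hI.mem_Icc e (hL.1 heL)
    rw [hσe e he]
    exact mem_normEdges_inl.2 ⟨hL.1 heL, lt_of_le_of_ne h0 fun h => hz ⟨e, heL, h.symm⟩,
      lt_of_le_of_ne h1 (Finset.mem_filter.1 he).2⟩
  have key := hI.isNormalized.lintegral_prod_selection_le (R := L'.image Prod.snd) (σ := σ)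
    (by
      intro v hv
      obtain ⟨e, he, rfl⟩ := Finset.mem_image.1 hv
      exact hedge e he)
    (by
      intro v hv v' hv' hne
      obtain ⟨e, he, rfl⟩ := Finset.mem_image.1 hv
      obtain ⟨e', he', rfl⟩ := Finset.mem_image.1 hv'
      rw [hσe e he, hσe e' he'] at hne
      rw [hσe e he]
      have h1 : e.1 ≠ e'.1 := fun h => hne (congrArg Sum.inl h)
      have h2 : e.2 ≠ e'.2 := fun h => h1 (congrArg Prod.fst (hinj' he he' h))
      -- Every non-dummy edge of the normalized graph is an edge of `E`, so stability is inherited.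
      exact fun h => hL.2 e (hsub he) e' (hsub he') h1 h2 (mem_normEdges_inl.1 h).1)
  have hprod : ∀ Z, ENNReal.ofReal (∏ e ∈ L, roundedVector E x Z e)
      = ∏ v ∈ L'.image Prod.snd,
        ENNReal.ofReal (selection (normEdges E x) (normX E x) Z (σ v, v)) := by
    intro Z
    rw [Finset.prod_image hinj', ← ENNReal.ofReal_prod_of_nonneg
      (fun _ _ => selection_nonneg Z _), hL', Finset.prod_filter]
    refine congrArg _ (Finset.prod_congr rfl fun e he => ?_)
    split_ifs with h
    · rw [hσe e (Finset.mem_filter.2 ⟨he, h⟩), roundedVector_of_ne_one Z h]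
    · exact roundedVector_of_eq_one Z (hL.1 he) (not_not.1 h)
  have hprodx : ∏ v ∈ L'.image Prod.snd, ENNReal.ofReal (normX E x (σ v, v))
      = ENNReal.ofReal (∏ e ∈ L, x e) := by
    rw [Finset.prod_image hinj', ENNReal.ofReal_prod_of_nonneg hx0, hL', Finset.prod_filter]
    refine Finset.prod_congr rfl fun e he => ?_
    split_ifs with h
    · rw [hσe e (Finset.mem_filter.2 ⟨he, h⟩)]; rfl
    · rw [not_not.1 h, ENNReal.ofReal_one]
  simp only [hprod]
  exact key.trans hprodx.le

theorem integral_mul_depRound_le {u : U} {v₁ v₂ : V} (hne : v₁ ≠ v₂) (h₁ : (u, v₁) ∈ E)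
    (h₂ : (u, v₂) ∈ E) :
    ∫ X, X (u, v₁) * X (u, v₂) ∂(depRound E x ρ)
      ≤ (1 - Phi (x (u, v₁)) (x (u, v₂)) (ρ (u, v₁)) (ρ (u, v₂))) * (x (u, v₁) * x (u, v₂)) := by
  by_cases hc : x (u, v₁) ∈ Set.Ioo (0 : ℝ) 1 ∧ x (u, v₂) ∈ Set.Ioo (0 : ℝ) 1 ∧
      ρ (u, v₁) ∈ Set.Ioo (0 : ℝ) 1 ∧ ρ (u, v₂) ∈ Set.Ioo (0 : ℝ) 1
  · obtain ⟨hx₁, hx₂, hρ₁, hρ₂⟩ := hc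
    have hΦ := Phi_mem_Icc (x (u, v₁)) (x (u, v₂)) (ρ (u, v₁)) (ρ (u, v₂))
    refine integral_depRound_le (g := fun X => X (u, v₁) * X (u, v₂))
      ((measurable_pi_apply _).mul (measurable_pi_apply _))
      (mul_nonneg (sub_nonneg.2 hΦ.2) (mul_nonneg hx₁.1.le hx₂.1.le))
      (fun Z => mul_nonneg (roundedVector_nonneg Z) (roundedVector_nonneg Z)) ?_
    simp only [roundedVector_of_ne_one _ hx₁.2.ne, roundedVector_of_ne_one _ hx₂.2.ne,
      ENNReal.ofReal_mul (selection_nonneg _ _)]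
    refine (hI.isNormalized.lintegral_selection_pair_le hne (u := Sum.inl u)
      (mem_normEdges_inl.2 ⟨h₁, hx₁⟩) (mem_normEdges_inl.2 ⟨h₂, hx₂⟩) hx₁ hx₂ hρ₁ hρ₂).trans
      (le_of_eq ?_)
    rw [mul_comm]
    rfl
  -- Outside the open cube only nonpositive correlation is claimed, and two edges at a common
  -- left-node form a stable set.
  · have hΦ : Phi (x (u, v₁)) (x (u, v₂)) (ρ (u, v₁)) (ρ (u, v₂)) = 0 := if_neg hc
    have hne' : (u, v₁) ≠ (u, v₂) := fun h => hne (congrArg Prod.snd h)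
    have hstable : IsStable E {(u, v₁), (u, v₂)} := by
      have hmem : ∀ e ∈ ({(u, v₁), (u, v₂)} : Finset (U × V)), e = (u, v₁) ∨ e = (u, v₂) := by
        intro e he; simpa using he
      refine ⟨fun e he => ?_, fun e he e' he' h => absurd ?_ h⟩
      · rcases hmem e he with rfl | rfl
        exacts [h₁, h₂]
      · rcases hmem e he with rfl | rfl <;> rcases hmem e' he' with rfl | rfl <;> rfl
    have := hI.integral_prod_depRound_le hstable
    simp only [Finset.prod_pair hne'] at this
    rwa [hΦ, sub_zero, one_mul]

end IsInstance

end Reduction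

end DepRounding

/-! ### The rounding theorem -/

theorem theorem1 {U V : Type*} [Fintype U] [DecidableEq U] [Fintype V] [DecidableEq V]
    (E : Finset (U × V)) (x ρ : U × V → ℝ)
    (hx : ∀ e ∈ E, x e ∈ Set.Icc (0 : ℝ) 1)
    (hρ : ∀ e ∈ E, ρ e ∈ Set.Icc (0 : ℝ) 1)
    (hxV : ∀ v : V, ∑ e ∈ DepRounding.rightEdges E v, x e ≤ 1)
    (hρU : ∀ u : U, ∑ e ∈ DepRounding.leftEdges E u, ρ e ≤ 1) :
    -- the output is a random 0/1 vector
    IsProbabilityMeasure (DepRounding.depRound E x ρ) ∧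
    (∀ᵐ X ∂(DepRounding.depRound E x ρ), ∀ e ∈ E, X e = 0 ∨ X e = 1) ∧
    -- each right-node has at most one chosen edge
    (∀ᵐ X ∂(DepRounding.depRound E x ρ),
      ∀ v : V, ∑ e ∈ DepRounding.rightEdges E v, X e ≤ 1) ∧
    -- the marginals are preserved
    (∀ e ∈ E, ∫ X, X e ∂(DepRounding.depRound E x ρ) = x e) ∧
    -- nonpositive correlation on stable edge-sets
    (∀ L : Finset (U × V), DepRounding.IsStable E L →
      ∫ X, ∏ e ∈ L, X e ∂(DepRounding.depRound E x ρ) ≤ ∏ e ∈ L, x e) ∧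
    -- strong negative correlation of two distinct edges at a common left-node
    (∀ (u : U) (v₁ v₂ : V), v₁ ≠ v₂ → (u, v₁) ∈ E → (u, v₂) ∈ E →
      ∫ X, X (u, v₁) * X (u, v₂) ∂(DepRounding.depRound E x ρ) ≤
        (1 - DepRounding.Phi (x (u, v₁)) (x (u, v₂)) (ρ (u, v₁)) (ρ (u, v₂))) *
          (x (u, v₁) * x (u, v₂))) ∧
    -- the range of `Φ` on the unit cube
    (∀ x₁ ∈ Set.Icc (0 : ℝ) 1, ∀ x₂ ∈ Set.Icc (0 : ℝ) 1,
      ∀ ρ₁ ∈ Set.Icc (0 : ℝ) 1, ∀ ρ₂ ∈ Set.Icc (0 : ℝ) 1,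
        DepRounding.Phi x₁ x₂ ρ₁ ρ₂ ∈ Set.Icc (0 : ℝ) 1) := by
  have hI : DepRounding.IsInstance E x ρ := ⟨hx, hρ, hxV, hρU⟩
  have hXm := DepRounding.measurable_roundedVector E x
  refine ⟨hI.isProbabilityMeasure_depRound, ?_, ?_, fun e he => hI.integral_depRound_apply he,
    fun L hL => hI.integral_prod_depRound_le hL,
    fun u v₁ v₂ hne h₁ h₂ => hI.integral_mul_depRound_le hne h₁ h₂,
    fun x₁ _ x₂ _ ρ₁ _ ρ₂ _ => DepRounding.Phi_mem_Icc x₁ x₂ ρ₁ ρ₂⟩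
  · rw [DepRounding.depRound_eq_map, ae_map_iff hXm.aemeasurable]
    · exact ae_of_all _ fun Z e _ => DepRounding.roundedVector_eq_zero_or_one Z
    · simp only [Set.ofPred_forall]
      refine Finset.measurableSet_biInter _ fun e _ => ?_
      exact (measurableSet_eq_fun (measurable_pi_apply e) measurable_const).union
        (measurableSet_eq_fun (measurable_pi_apply e) measurable_const)
  · rw [DepRounding.depRound_eq_map, ae_map_iff hXm.aemeasurable]
    · exact ae_of_all _ fun Z v => hI.sum_roundedVector_le_one Z v
    · simp only [Set.ofPred_forall]
      refine MeasurableSet.iInter fun v => measurableSet_le ?_ measurable_const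
      exact Finset.measurable_fun_sum _ fun e _ => measurable_pi_apply e
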